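/- Let $C\in\mathbb{R}^{m\times n}$ be a matrix with nonnegative entries, with rows indexed by $I$, $|I|=m\ge 1$, and columns indexed by $V$, $|V|=n$. Put $F(\emptyset)=0$ and $F(A)=\sum_{i\in I}\max_{v\in A}C_{iv}$ for nonempty $A\subseteq V$; for $1\le k\le n$ let $\mathrm{OPT}=\max_{|A|\le k}F(A)$. A $t$-nearest neighbor graph $T$ of $C$ (with $t\ge1$) joins each row to $\min\{t,n\}$ columns with the largest entries of that row (ties broken arbitrarily), and the $t$-sparsified matrix is obtained from $C$ by replacing all entries outside $T$ by $0$. For $0<\varepsilon<1$, stochastic greedy on the sparsified problem starts with $A=\emptyset$ and performs $k$ iterations; in each it draws, independently of the past, a uniformly random sample set of $s=\min\{n,\lceil\frac nk\ln\frac2\varepsilon\rceil\}$ distinct columns of $V$ and adds to $A$ an element of the sample whose gain for the sparsified objective is largest (ties broken by any fixed rule). Gains are computed from the adjacency lists of $T$ with a cache of the current benefit of every row. Its running time is the number of elementary steps (memory accesses, real arithmetic operations and comparisons, drawings of one sample element) performed once the sparsified matrix and the graph $T$ are given. For $\alpha>0$ let $t^*(\alpha)$ be the smallest integer $t\ge 1$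 such that $\frac nx\bigl(1+\ln\frac{mx}{n}\bigr)\le\alpha k$ for all real $x\ge t$. 1. For all $c>0$ and $0<\varepsilon_0<1$ there is a constant $K$ such that, whenever $m\le cn$, $1\le k\le n$, $t\ge1$ and $0<\varepsilon\le\varepsilon_0$, the running time is at most $K\,n\log\frac1\varepsilon\,\max\{t,\log n\}$ with probability at least $1-\frac1n$. 2. There is an absolute constant $B$ such that $t^*(\varepsilon/2)\le B\,\frac{n}{\varepsilon k}\max\bigl\{1,\log\frac{m}{\varepsilon k}\bigr\}$ for all $m\ge 1$, $1\le k\le n$ and $0<\varepsilon<1$. If $t\ge t^*(\varepsilon/2)$, the set $A$ returned by the algorithm satisfies $\mathbb{E}[F(A)]\ge(1-\frac1e-\varepsilon)\,\mathrm{OPT}$. -/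

import Mathlib

noncomputable section

namespace FacilityLocation

/-- The facility location objective of a benefit matrix `C` (rows are the `m` elements of `I`,
columns are the `n` elements of `V`): the sum over the rows of the best entry in the selected
columns, and `0` for the empty selection. -/
def objective {n m : ℕ} (C : Fin m → Fin n → ℝ) (A : Finset (Fin n)) : ℝ :=
  if h : A.Nonempty then ∑ i, A.sup' h (C i) else 0

/-- The optimal value of the objective over all selections of at most `k` columns. -/
def opt {n m : ℕ} (C : Fin m → Fin n → ℝ) (k : ℕ) : ℝ :=
  ((Finset.univ : Finset (Finset (Fin n))).filter (fun A => A.card ≤ k)).sup'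
    ⟨∅, by simp⟩ (objective C)

/-- `T` is a `t`-nearest neighbour graph of `C`: every row `i` is joined to `t` columns (to all
columns if there are fewer than `t`) whose entries are the largest ones of the row. Ties may be
resolved in any way. -/
structure IsNearestNeighborGraph {n m : ℕ} (C : Fin m → Fin n → ℝ) (t : ℕ)
    (T : Fin m → Finset (Fin n)) : Prop where
  card_eq : ∀ i, (T i).card = min t n
  le_of_mem : ∀ i, ∀ v ∈ T i, ∀ w, w ∉ T i → C i w ≤ C i v

/-- The sparsified matrix: entries outside the graph `T` are replaced by zero. -/
def sparsify {n m : ℕ} (C : Fin m → Fin n → ℝ) (T : Fin m → Finset (Fin n)) :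
    Fin m → Fin n → ℝ :=
  fun i v => if v ∈ T i then C i v else 0

/-- The adjacency list of the column `v` in the graph `T`. -/
def neighbors {n m : ℕ} (T : Fin m → Finset (Fin n)) (v : Fin n) : List (Fin m) :=
  (List.finRange m).filter (fun i => decide (v ∈ T i))

/-- A computation that returns a value together with the number of steps it has used. -/
structure Timed (α : Type) where
  val : α
  time : ℕ

instance : Monad Timed where
  pure a := ⟨a, 0⟩
  bind x f := ⟨(f x.val).val, x.time + (f x.val).time⟩

/-- One elementary step: a memory access, an arithmetic operation or comparison of real numbers, or
the drawing of one random element. -/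
def step {α : Type} (a : α) : Timed α := ⟨a, 1⟩

/-- The gain of the column `v`, computed from its adjacency list and the cached benefits `β`. -/
def gain {n m : ℕ} (C : Fin m → Fin n → ℝ) (T : Fin m → Finset (Fin n)) (β : Fin m → ℝ)
    (v : Fin n) : Timed ℝ :=
  (neighbors T v).foldlM (fun g i => do
    let i ← step i
    let c ← step (C i v)
    let b ← step (β i)
    let d ← step (c - b)
    let x ← step (max d 0)
    step (g + x)) 0

/-- Scan of a sample for an element of largest gain. The current candidate `best` is replaced when
the new gain is larger, or when it is equal and `tie` prefers the new element. -/
def bestOf {n m : ℕ} (C : Fin m → Fin n → ℝ) (T : Fin m → Finset (Fin n))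
    (tie : Fin n → Fin n → Bool) (β : Fin m → ℝ) (sample : List (Fin n)) :
    Timed (Option (Fin n × ℝ)) :=
  sample.foldlM (fun best v => do
    let v ← step v
    let g ← gain C T β v
    match best with
    | none => step (some (v, g))
    | some (u, h) => do
      let larger ← step (decide (h < g))
      let equal ← step (decide (h = g))
      let preferred ← step (tie v u)
      step (if larger = true ∨ (equal = true ∧ preferred = true) then some (v, g)
        else some (u, h))) none

/-- Update of the cached benefits after the column `v` has been selected. -/
def updateCache {n m : ℕ} (C : Fin m → Fin n → ℝ) (T : Fin m → Finset (Fin n)) (v : Fin n)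
    (β : Fin m → ℝ) : Timed (Fin m → ℝ) :=
  (neighbors T v).foldlM (fun β i => do
    let i ← step i
    let b ← step (β i)
    let c ← step (C i v)
    let x ← step (max b c)
    step (Function.update β i x)) β

/-- One iteration: find the best element of the sample, select it, update the cache. The state
consists of the cached benefits and the list of the columns selected so far. -/
def iteration {n m : ℕ} (C : Fin m → Fin n → ℝ) (T : Fin m → Finset (Fin n))
    (tie : Fin n → Fin n → Bool) (state : (Fin m → ℝ) × List (Fin n)) (sample : List (Fin n)) :
    Timed ((Fin m → ℝ) × List (Fin n)) := do
  let best ← bestOf C T tie state.1 sample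
  match best with
  | none => step state
  | some (v, _) => do
    let A ← step (v :: state.2)
    let β ← updateCache C T v state.1
    step (β, A)

/-- Initialization of the cache: every row currently receives no benefit. -/
def initCache (m : ℕ) (β : Fin m → ℝ) : Timed (Fin m → ℝ) :=
  (List.finRange m).foldlM (fun β i => do
    let i ← step i
    step (Function.update β i 0)) β

/-- The possible outcomes of the random draws: in each of the `k` iterations, `s` distinct columns
are drawn one after the other, without replacement. -/
abbrev Samples (n k s : ℕ) : Type := Fin k → (Fin s ↪ Fin n)

/-- Stochastic greedy with `k` iterations and sample sets of size `s`, for the matrix `C` with the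
sparsity graph `T`, on the outcome `ω` of the random draws. -/
def stochasticGreedy {n m k s : ℕ} (C : Fin m → Fin n → ℝ) (T : Fin m → Finset (Fin n))
    (tie : Fin n → Fin n → Bool) (ω : Samples n k s) : Timed (List (Fin n)) := do
  let β ← initCache m (fun _ => 0)
  let final ← (List.finRange k).foldlM (fun state j => do
    let j ← step j
    iteration C T tie state (List.ofFn (ω j))) (β, [])
  pure final.2

/-- The set selected by stochastic greedy. -/
def selected {n m k s : ℕ} (C : Fin m → Fin n → ℝ) (T : Fin m → Finset (Fin n))
    (tie : Fin n → Fin n → Bool) (ω : Samples n k s) : Finset (Fin n) :=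
  (stochasticGreedy C T tie ω).val.toFinset

/-- The number of steps of stochastic greedy. -/
def runningTime {n m k s : ℕ} (C : Fin m → Fin n → ℝ) (T : Fin m → Finset (Fin n))
    (tie : Fin n → Fin n → Bool) (ω : Samples n k s) : ℕ :=
  (stochasticGreedy C T tie ω).time

/-- The size of the sample sets, `(n / k) log (2 / ε)` rounded up to an integer, or all of the `n`
columns if this is larger than `n`. -/
def sampleSize (n k : ℕ) (ε : ℝ) : ℕ :=
  min n ⌈(n : ℝ) / k * Real.log (2 / ε)⌉₊

/-- Expectation when the samples are uniformly distributed, that is, when the sample sets are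
independent and uniform. -/
def expectation {n k s : ℕ} (X : Samples n k s → ℝ) : ℝ :=
  (∑ ω, X ω) / Fintype.card (Samples n k s)

open Classical in
/-- Probability of an event when the samples are uniformly distributed. -/
def probability {n k s : ℕ} (E : Samples n k s → Prop) : ℝ :=
  expectation (fun ω => if E ω then 1 else 0)

/-- The sparsity threshold `t*(α)`: the smallest positive integer from which on
`(n / x) (1 + log (m x / n))` is at most `α k`. If `n ≤ m`, this expression decreases in `x ≥ 1`, so
that `t*(α)` is just the smallest positive integer at which it is at most `α k`. -/
def tStar (n m k : ℕ) (α : ℝ) : ℕ :=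
  sInf {t : ℕ | 1 ≤ t ∧ ∀ x : ℝ, (t : ℝ) ≤ x →
    (n : ℝ) / x * (1 + Real.log (m * x / n)) ≤ α * k}

end FacilityLocation

end

/-!
The approximation guarantee combines a bound for the loss from sparsification with one for greedy.
Deleting the entries outside the graph costs little: if every column is chosen with probability `q
= log (m t / n) / t`, and one neighbour is added for every row that is not yet hit, about `(n / t)
(1 + log (m t / n)) ≤ α k` columns contain a neighbour of every row (`exists_hittingSet`). Adding
them to an optimal set recovers its value on the sparsified matrix, since a neighbour of a row is
at least as good as any non-neighbour, and deleting cheapest columns until `k` are left keeps a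
fraction of at least `1 / (1 + α)` (`exists_subset_value`, `exists_value_sparsify_ge`). Stochastic
greedy is then analysed on the sparsified matrix. A sample meets a fixed set `O` of `k` columns
with probability at least `1 - ε / 2`, and given that it does, a random element of the
intersection is uniform on `O`; by submodularity its gain is, in the mean, at least `1 / k` of the
gap to the value of `O` (`sum_gap_iteration_le`). Iterating `k` times leaves a gap of at most `exp
(-(1 - ε / 2)) ≤ 1 / e + ε / 2` times the value of `O` (`le_sum_value_selected`).

The running time is, up to constants, `m` plus the number of draws plus the total degree of the
drawn columns (`runningTime_le`). The degrees are at most `m ≤ c n` and add up to at most `m t`.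
Divided by `c n` they are weights in `[0, 1]`, and a Chernoff bound (`card_weight_gt_le`) applies:
the samples of different iterations are independent, and within a sample, drawing without
replacement at most doubles the conditional mean weight as long as half of the columns are left,
while a sample of more than half of the columns is compared with the set of all columns.

The bound for the threshold is elementary calculus in the variable `y = ε k x / n`
(`threshold_condition_of_le`).
-/

noncomputable section

namespace FacilityLocation

open Finset

/-! ### Sampling without replacement -/

/-- Sequential drawing: if, given the elements drawn so far, the average of `g` over the remaining
elements is at most `c`, then the product of `g` over a uniform sample has mean at most `c ^ s`.
Only initial draws on which `g` does not vanish matter. -/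
theorem sum_embedding_prod_le {α : Type*} [Fintype α] [DecidableEq α] (g : α → ℝ)
    (hg : ∀ a, 0 ≤ g a) {c : ℝ} (hc : 0 ≤ c) (s : ℕ)
    (h : ∀ r < s, ∀ e : Fin r ↪ α, (∀ i, g (e i) ≠ 0) →
      ∑ a : {a // a ∉ Set.range e}, g a ≤ ((Fintype.card α - r : ℕ) : ℝ) * c) :
    ∑ f : Fin s ↪ α, ∏ i, g (f i) ≤ Fintype.card (Fin s ↪ α) * c ^ s := by
  induction s with
  | zero => simp
  | succ s ih =>
    have ih' := ih fun r hr => h r (hr.trans (Nat.lt_succ_self s))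
    have hcard : (Fintype.card (Fin (s + 1) ↪ α) : ℝ)
        = ((Fintype.card α - s : ℕ) : ℝ) * Fintype.card (Fin s ↪ α) := by
      rw [Fintype.card_embedding_eq, Fintype.card_embedding_eq, Fintype.card_fin,
        Fintype.card_fin, Nat.descFactorial_succ, Nat.cast_mul]
    rw [← (Equiv.embeddingFinSucc s α).symm.sum_comp, Fintype.sum_sigma]
    calc ∑ e : Fin s ↪ α, ∑ a : {a // a ∉ Set.range e},
          ∏ i, g ((Equiv.embeddingFinSucc s α).symm ⟨e, a⟩ i)
        = ∑ e : Fin s ↪ α, (∏ i, g (e i)) * ∑ a : {a // a ∉ Set.range e}, g a := by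
          refine sum_congr rfl fun e _ => ?_
          rw [mul_sum]
          refine sum_congr rfl fun a _ => ?_
          simp only [Equiv.coe_embeddingFinSucc_symm, Fin.prod_univ_succ, Fin.cons_zero,
            Fin.cons_succ]
          ring
      _ ≤ ∑ e : Fin s ↪ α, (∏ i, g (e i)) * (((Fintype.card α - s : ℕ) : ℝ) * c) := by
          refine sum_le_sum fun e _ => ?_
          by_cases he : ∀ i, g (e i) ≠ 0
          · exact mul_le_mul_of_nonneg_left (h s (Nat.lt_succ_self s) e he)
              (prod_nonneg fun i _ => hg _)
          · push Not at he
            obtain ⟨i, hi⟩ := he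
            rw [prod_eq_zero (mem_univ i) hi, zero_mul, zero_mul]
      _ ≤ (Fintype.card (Fin s ↪ α) * c ^ s) * (((Fintype.card α - s : ℕ) : ℝ) * c) := by
          rw [← sum_mul]
          exact mul_le_mul_of_nonneg_right ih' (by positivity)
      _ = _ := by rw [hcard]; ring

/-- The moment bound behind the tail estimate: `∏ (1 + x)` over a uniform sample of size `s` has
mean at most `exp (2 s X / n)`, where `X` is the sum of `x` over all of the `n` elements. -/
theorem sum_embedding_prod_one_add_le {α : Type*} [Fintype α] [DecidableEq α] [Nonempty α]
    (x : α → ℝ) (hx : ∀ a, 0 ≤ x a) (s : ℕ) :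
    ∑ f : Fin s ↪ α, ∏ i, (1 + x (f i)) ≤
      Fintype.card (Fin s ↪ α) * Real.exp (2 * s * (∑ a, x a) / Fintype.card α) := by
  have hn : (0 : ℝ) < Fintype.card α := by exact_mod_cast Fintype.card_pos
  set X := ∑ a, x a with hX
  have hX0 : 0 ≤ X := sum_nonneg fun a _ => hx a
  by_cases hs : 2 * s ≤ Fintype.card α
  · -- At least half of the elements remain at each draw.
    refine (sum_embedding_prod_le (fun a => 1 + x a) (fun a => by linarith [hx a])
      (c := 1 + 2 * X / Fintype.card α) (by positivity) s ?_).trans ?_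
    · intro r hr e _
      have hc : Fintype.card {a // a ∉ Set.range e} = Fintype.card α - r := by
        rw [Fintype.card_subtype_compl, Fintype.card_range, Fintype.card_fin]
      have h1 : ∑ a : {a // a ∉ Set.range e}, x a ≤ X := by
        rw [← sum_subtype (univ.filter fun a => a ∉ Set.range e) (by simp) x]
        exact sum_le_sum_of_subset_of_nonneg (filter_subset _ _) fun a _ _ => hx a
      rw [sum_add_distrib, sum_const, card_univ, hc, nsmul_eq_mul, mul_one]
      have h2 : (Fintype.card α : ℝ) ≤ 2 * ((Fintype.card α - r : ℕ) : ℝ) := by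
        exact_mod_cast (by omega : Fintype.card α ≤ 2 * (Fintype.card α - r))
      have h3 : X ≤ ((Fintype.card α - r : ℕ) : ℝ) * (2 * X / Fintype.card α) := by
        rw [mul_div_assoc', le_div_iff₀ hn]
        nlinarith
      linarith
    · refine mul_le_mul_of_nonneg_left ?_ (Nat.cast_nonneg _)
      calc (1 + 2 * X / Fintype.card α) ^ s
          ≤ Real.exp (2 * X / Fintype.card α) ^ s := by
            refine pow_le_pow_left₀ (by positivity) ?_ s
            linarith [Real.add_one_le_exp (2 * X / Fintype.card α)]
        _ = _ := by rw [← Real.exp_nat_mul]; congr 1; ring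
  · -- A sample of more than half of the elements is compared with all of them.
    have hpt : ∀ f : Fin s ↪ α,
        ∏ i, (1 + x (f i)) ≤ Real.exp (2 * s * X / Fintype.card α) := by
      intro f
      calc ∏ i, (1 + x (f i)) ≤ ∏ i, Real.exp (x (f i)) :=
            prod_le_prod (fun i _ => by linarith [hx (f i)])
              fun i _ => by linarith [Real.add_one_le_exp (x (f i))]
        _ = Real.exp (∑ i, x (f i)) := (Real.exp_sum _ _).symm
        _ ≤ _ := by
            refine Real.exp_le_exp.mpr ?_
            have h1 : ∑ i, x (f i) ≤ X := by
              rw [← sum_map univ f x]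
              exact sum_le_sum_of_subset_of_nonneg (subset_univ _) fun a _ _ => hx a
            have h2 : (Fintype.card α : ℝ) ≤ 2 * s := by
              exact_mod_cast (by omega : Fintype.card α ≤ 2 * s)
            refine h1.trans ?_
            rw [le_div_iff₀ hn]
            nlinarith
    refine (sum_le_sum fun f _ => hpt f).trans ?_
    simp

/-- A uniform sample of size `s` misses a set `O` with probability at most `(1 - |O| / n) ^ s`. -/
theorem card_embedding_disjoint_le {α : Type*} [Fintype α] [DecidableEq α] [Nonempty α]
    (O : Finset α) (s : ℕ) :
    ((univ.filter fun f : Fin s ↪ α => ∀ i, f i ∉ O).card : ℝ) ≤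
      Fintype.card (Fin s ↪ α) * (1 - O.card / Fintype.card α) ^ s := by
  have hn : (0 : ℝ) < Fintype.card α := by exact_mod_cast Fintype.card_pos
  have key := sum_embedding_prod_le (fun a => if a ∈ O then (0 : ℝ) else 1)
    (fun a => by split_ifs <;> norm_num) (c := 1 - O.card / Fintype.card α)
    (sub_nonneg.mpr ((div_le_one hn).mpr (by exact_mod_cast card_le_univ O))) s ?_
  · refine le_trans (le_of_eq ?_) key
    rw [card_filter, Nat.cast_sum]
    refine sum_congr rfl fun f _ => ?_
    by_cases h : ∀ i, f i ∉ O
    · simp [h]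
    · rw [if_neg h]
      push Not at h
      obtain ⟨i, hi⟩ := h
      rw [Nat.cast_zero]
      exact Eq.symm (prod_eq_zero (i := i) (mem_univ _) (by simp [hi]))
  · intro r _ e he
    have he' : ∀ i, e i ∉ O := fun i hi => he i (if_pos hi)
    have hdisj : Disjoint O (univ.map e) := by
      rw [disjoint_right]
      intro a ha
      obtain ⟨i, -, rfl⟩ := mem_map.mp ha
      exact he' i
    have hle : O.card + r ≤ Fintype.card α := by
      have := card_le_univ (O ∪ univ.map e)
      rwa [card_union_of_disjoint hdisj, card_map, card_univ, Fintype.card_fin] at this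
    have hsum : ∑ a : {a // a ∉ Set.range e}, (if (a : α) ∈ O then (0 : ℝ) else 1)
        = Fintype.card α - (O.card + r) := by
      rw [← sum_subtype (univ.filter fun a => a ∉ Set.range e) (by simp)
        (fun a => if a ∈ O then (0 : ℝ) else 1)]
      have : ∀ a, (if a ∈ O then (0 : ℝ) else 1) = if a ∉ O then 1 else 0 := fun a => by
        by_cases h : a ∈ O <;> simp [h]
      simp only [this]
      rw [sum_boole, filter_filter]
      have : (univ.filter fun a => a ∉ Set.range e ∧ a ∉ O) = (O ∪ univ.map e)ᶜ := by
        ext a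
        simp only [mem_filter, mem_univ, true_and, mem_compl, mem_union, mem_map, Set.mem_range]
        tauto
      rw [this, card_compl, card_union_of_disjoint hdisj, card_map, card_univ, Fintype.card_fin,
        Nat.cast_sub hle]
      push_cast; ring
    rw [hsum, Nat.cast_sub (by omega)]
    have : (0 : ℝ) ≤ r * (O.card / Fintype.card α) := by positivity
    have h2 : (Fintype.card α : ℝ) * (O.card / Fintype.card α) = O.card := by
      field_simp
    nlinarith

/-- The best value over the sampled elements of `O` is, in the mean, at least the probability of
meeting `O` times the average value over `O`. Given that the sample meets `O`, a uniformly random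
element of the intersection is uniformly distributed on `O`: the swap of two elements of `O`
preserves the distribution of the sample. -/
theorem sum_embedding_hit_le {α : Type*} [Fintype α] [DecidableEq α] (O : Finset α)
    (d : α → ℝ) (s : ℕ) (M : (Fin s ↪ α) → ℝ) (hM0 : ∀ f, 0 ≤ M f) (hM : ∀ f i, d (f i) ≤ M f) :
    ((univ.filter fun f : Fin s ↪ α => ∃ i, f i ∈ O).card : ℝ) * ∑ o ∈ O, d o ≤
      O.card * ∑ f, M f := by
  -- `p f o` is the probability that `o` is the random element of the intersection.
  let N : (Fin s ↪ α) → ℕ := fun f => (O.filter fun a => a ∈ Set.range f).card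
  let p : (Fin s ↪ α) → α → ℝ := fun f o => if o ∈ Set.range f then (N f : ℝ)⁻¹ else 0
  have hsum : ∀ f, ∑ o ∈ O, p f o = if ∃ i, f i ∈ O then 1 else 0 := by
    intro f
    have h1 : ∑ o ∈ O, p f o = N f * (N f : ℝ)⁻¹ := by
      rw [← sum_filter, sum_const, nsmul_eq_mul]
    rw [h1]
    split_ifs with h
    · obtain ⟨i, hi⟩ := h
      have : 0 < N f := card_pos.mpr ⟨f i, mem_filter.mpr ⟨hi, i, rfl⟩⟩
      exact mul_inv_cancel₀ (by positivity)
    · have : N f = 0 := by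
        refine card_eq_zero.mpr (filter_eq_empty_iff.mpr ?_)
        rintro o ho ⟨i, rfl⟩
        exact h ⟨i, ho⟩
      simp [this]
  have hsymm : ∀ o ∈ O, ∀ o' ∈ O, ∑ f, p f o = ∑ f, p f o' := by
    intro o ho o' ho'
    refine Fintype.sum_equiv (Equiv.embeddingCongr (Equiv.refl _) (Equiv.swap o o')) _ _ ?_
    intro f
    set f' := Equiv.embeddingCongr (Equiv.refl _) (Equiv.swap o o') f with hf'
    have hr : ∀ a, Equiv.swap o o' a ∈ Set.range f' ↔ a ∈ Set.range f := by
      intro a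
      simp [hf', Equiv.embeddingCongr]
    have hO : ∀ a ∈ O, Equiv.swap o o' a ∈ O := by
      intro a ha
      by_cases h1 : a = o
      · rw [h1, Equiv.swap_apply_left]; exact ho'
      · by_cases h2 : a = o'
        · rw [h2, Equiv.swap_apply_right]; exact ho
        · rwa [Equiv.swap_apply_of_ne_of_ne h1 h2]
    have hN : N f = N f' := by
      refine card_bij' (fun a _ => Equiv.swap o o' a) (fun a _ => Equiv.swap o o' a) ?_ ?_ ?_ ?_
      · intro a ha
        rw [mem_filter] at ha ⊢
        exact ⟨hO a ha.1, (hr a).mpr ha.2⟩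
      · intro a ha
        rw [mem_filter] at ha ⊢
        refine ⟨hO a ha.1, ?_⟩
        rw [← hr, Equiv.swap_apply_self]
        exact ha.2
      · intro a _; exact Equiv.swap_apply_self _ _ _
      · intro a _; exact Equiv.swap_apply_self _ _ _
    have h2 := hr o
    rw [Equiv.swap_apply_left] at h2
    simp only [p, hN, h2]
  rcases O.eq_empty_or_nonempty with rfl | ⟨o₀, ho₀⟩
  · simp
  set w := ∑ f, p f o₀ with hw
  have hhit : ((univ.filter fun f : Fin s ↪ α => ∃ i, f i ∈ O).card : ℝ) = O.card * w := by
    rw [← sum_boole]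
    simp only [← hsum]
    rw [sum_comm, sum_congr rfl fun o ho => hsymm o ho o₀ ho₀, sum_const, nsmul_eq_mul]
  have hmain : w * ∑ o ∈ O, d o ≤ ∑ f, M f := by
    calc w * ∑ o ∈ O, d o = ∑ o ∈ O, (∑ f, p f o) * d o := by
          rw [mul_sum]
          exact sum_congr rfl fun o ho => by rw [hw, hsymm o ho o₀ ho₀]
      _ = ∑ f, ∑ o ∈ O, p f o * d o := by
          simp only [sum_mul]
          exact sum_comm
      _ ≤ ∑ f, ∑ o ∈ O, p f o * M f := by
          refine sum_le_sum fun f _ => sum_le_sum fun o _ => ?_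
          simp only [p]
          split_ifs with h
          · obtain ⟨i, rfl⟩ := h
            exact mul_le_mul_of_nonneg_left (hM f i) (by positivity)
          · simp
      _ ≤ ∑ f, M f := by
          refine sum_le_sum fun f _ => ?_
          rw [← sum_mul, hsum]
          split_ifs
          · rw [one_mul]
          · rw [zero_mul]; exact hM0 f
  rw [hhit, mul_assoc]
  exact mul_le_mul_of_nonneg_left hmain (Nat.cast_nonneg _)

/-! ### The coverage function -/

variable {n m : ℕ}

/-- The benefit of the row `i` from the selection `A`. The value `0` for the empty selection is
built in, which for nonnegative entries does not change the value for nonempty ones. -/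
def coverage (C : Fin m → Fin n → ℝ) (A : Finset (Fin n)) (i : Fin m) : ℝ :=
  A.fold max 0 (C i)

/-- The total benefit of the selection `A`: for nonnegative matrices, the objective. -/
def value (C : Fin m → Fin n → ℝ) (A : Finset (Fin n)) : ℝ := ∑ i, coverage C A i

theorem coverage_le {C : Fin m → Fin n → ℝ} {A : Finset (Fin n)} {i : Fin m} {x : ℝ}
    (hx : 0 ≤ x) (h : ∀ v ∈ A, C i v ≤ x) : coverage C A i ≤ x :=
  (fold_max_le _).mpr ⟨hx, h⟩

theorem coverage_nonneg (C : Fin m → Fin n → ℝ) (A : Finset (Fin n)) (i : Fin m) :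
    0 ≤ coverage C A i :=
  (le_fold_max _).mpr (Or.inl le_rfl)

theorem le_coverage (C : Fin m → Fin n → ℝ) {A : Finset (Fin n)} (i : Fin m) {v : Fin n}
    (hv : v ∈ A) : C i v ≤ coverage C A i :=
  (le_fold_max _).mpr (Or.inr ⟨v, hv, le_rfl⟩)

theorem coverage_insert (C : Fin m → Fin n → ℝ) (A : Finset (Fin n)) (i : Fin m) (v : Fin n) :
    coverage C (insert v A) i = max (coverage C A i) (C i v) := by
  rw [coverage, fold_insert_idem, max_comm, coverage]

theorem coverage_mono (C : Fin m → Fin n → ℝ) {A B : Finset (Fin n)} (h : A ⊆ B) (i : Fin m) :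
    coverage C A i ≤ coverage C B i :=
  coverage_le (coverage_nonneg C B i) fun _ hv => le_coverage C i (h hv)

theorem value_nonneg (C : Fin m → Fin n → ℝ) (A : Finset (Fin n)) : 0 ≤ value C A :=
  sum_nonneg fun i _ => coverage_nonneg C A i

theorem value_mono (C : Fin m → Fin n → ℝ) {A B : Finset (Fin n)} (h : A ⊆ B) :
    value C A ≤ value C B :=
  sum_le_sum fun i _ => coverage_mono C h i

theorem objective_eq_value {C : Fin m → Fin n → ℝ} (hC : ∀ i v, 0 ≤ C i v)
    (A : Finset (Fin n)) : objective C A = value C A := by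
  rw [objective, value]
  split_ifs with h
  · refine sum_congr rfl fun i _ => le_antisymm ?_ ?_
    · exact sup'_le h _ fun v hv => le_coverage C i hv
    · obtain ⟨v, hv⟩ := h
      exact coverage_le ((hC i v).trans (le_sup' (C i) hv)) fun w hw => le_sup' (C i) hw
  · rw [not_nonempty_iff_eq_empty.mp h]
    simp [coverage]

/-- Submodularity: adding `O` to a selection gains at most the sum of the single gains, here with
an arbitrary cache `β` of nonnegative benefits. -/
theorem value_sub_le_sum_gain (C : Fin m → Fin n → ℝ) (O : Finset (Fin n)) {β : Fin m → ℝ}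
    (hβ : ∀ i, 0 ≤ β i) :
    value C O - ∑ i, β i ≤ ∑ o ∈ O, ∑ i, max (C i o - β i) 0 := by
  rw [value, ← sum_sub_distrib, sum_comm]
  refine sum_le_sum fun i _ => ?_
  rw [sub_le_iff_le_add]
  have h0 : 0 ≤ ∑ o ∈ O, max (C i o - β i) 0 := sum_nonneg fun o _ => le_max_right _ _
  refine coverage_le (add_nonneg h0 (hβ i)) fun o ho => ?_
  have := single_le_sum (f := fun o => max (C i o - β i) 0) (fun o _ => le_max_right _ _) ho
  linarith [le_max_left (C i o - β i) 0]

/-- Since every row is served by a single column, the losses from deleting one column of `A` add up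
to at most the value of `A`; so some column can be deleted at an at most average loss. -/
theorem exists_erase_value (C : Fin m → Fin n → ℝ) {A : Finset (Fin n)} (hA : A.Nonempty) :
    ∃ v ∈ A, ((A.card : ℝ) - 1) * value C A ≤ A.card * value C (A.erase v) := by
  have key : ∑ v ∈ A, (value C A - value C (A.erase v)) ≤ value C A := by
    simp only [value, ← sum_sub_distrib]
    rw [sum_comm]
    refine sum_le_sum fun i _ => ?_
    have hle : ∀ v, 0 ≤ coverage C (A.erase v) i := fun v => coverage_nonneg C _ i
    rcases (le_fold_max _).mp (le_refl (coverage C A i)) with h0 | ⟨w, hw, hCw⟩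
    · refine (sum_nonpos fun v _ => ?_).trans (coverage_nonneg C A i)
      linarith [hle v]
    · rw [← add_sum_erase A _ hw]
      have h1 : ∑ v ∈ A.erase w, (coverage C A i - coverage C (A.erase v) i) ≤ 0 := by
        refine sum_nonpos fun v hv => ?_
        have := le_coverage C i (mem_erase.mpr ⟨(ne_of_mem_erase hv).symm, hw⟩ : w ∈ A.erase v)
        change coverage C A i ≤ C i w at hCw
        linarith
      linarith [hle w]
  by_contra hcon
  push Not at hcon
  have h1 : ∑ v ∈ A, (A.card : ℝ) * value C (A.erase v)
      < ∑ v ∈ A, ((A.card : ℝ) - 1) * value C A :=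
    sum_lt_sum_of_nonempty hA hcon
  rw [← mul_sum, sum_const, nsmul_eq_mul] at h1
  rw [sum_sub_distrib, sum_const, nsmul_eq_mul] at key
  have hpos : (0 : ℝ) < A.card := by exact_mod_cast hA.card_pos
  have h2 := lt_of_mul_lt_mul_left h1 hpos.le
  linarith

/-- Deleting cheapest columns one by one: `A` has a subset of `k` columns that keeps at least the
fraction `k / |A|` of its value. -/
theorem exists_subset_value (C : Fin m → Fin n → ℝ) {k : ℕ} (hk : 1 ≤ k) :
    ∀ (A : Finset (Fin n)), k ≤ A.card →
      ∃ B ⊆ A, B.card = k ∧ (k : ℝ) * value C A ≤ A.card * value C B := by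
  intro A hA
  induction hN : A.card generalizing A with
  | zero => omega
  | succ N ih =>
    rcases Nat.eq_or_lt_of_le hA with h | h
    · exact ⟨A, subset_rfl, h.symm, by rw [h, hN]⟩
    · obtain ⟨v, hv, hle⟩ := exists_erase_value C (card_pos.mp (by omega) : A.Nonempty)
      have hc : (A.erase v).card = N := by rw [card_erase_of_mem hv, hN]; rfl
      obtain ⟨B, hB, hBk, hval⟩ := ih (A.erase v) (by omega) hc
      refine ⟨B, hB.trans (erase_subset _ _), hBk, ?_⟩
      rw [hN] at hle
      push_cast at hle ⊢
      have hN0 : (0 : ℝ) < N := by exact_mod_cast (by omega : 0 < N)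
      have hk0 : (0 : ℝ) ≤ k := Nat.cast_nonneg k
      have h1 := mul_le_mul_of_nonneg_left hle hk0
      have h2 := mul_le_mul_of_nonneg_left hval (by positivity : (0 : ℝ) ≤ (N : ℝ) + 1)
      refine le_of_mul_le_mul_left (a := (N : ℝ)) ?_ hN0
      linarith

/-! ### Small hitting sets -/

/-- Choosing every column of `U` independently with probability `q` selects `q |U|` columns in the
mean and leaves the set `T i` unhit with probability `(1 - q) ^ |T i ∩ U|`. Some choice is at least
as good as the mean; it is found by deciding on one column after the other. -/
theorem exists_card_add_unhit_le {ι α : Type*} [DecidableEq α] (T : ι → Finset α) {q : ℝ}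
    (h0 : 0 ≤ q) (h1 : q ≤ 1) (U : Finset α) : ∀ I : Finset ι, ∃ Γ ⊆ U,
      (Γ.card : ℝ) + ((I.filter fun i => Disjoint (T i) Γ).card : ℝ) ≤
        q * U.card + ∑ i ∈ I, (1 - q) ^ (T i ∩ U).card := by
  induction U using Finset.induction_on with
  | empty => intro I; exact ⟨∅, subset_rfl, by simp⟩
  | insert v U hv ih =>
    intro I
    obtain ⟨Γ₁, hΓ₁, hle₁⟩ := ih (I.filter fun i => v ∉ T i)
    obtain ⟨Γ₀, hΓ₀, hle₀⟩ := ih I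
    set a := ∑ i ∈ I.filter (fun i => v ∉ T i), (1 - q) ^ (T i ∩ U).card with ha
    set b := ∑ i ∈ I.filter (fun i => ¬ v ∉ T i), (1 - q) ^ (T i ∩ U).card with hb
    have hab : ∑ i ∈ I, (1 - q) ^ (T i ∩ U).card = a + b :=
      (sum_filter_add_sum_filter_not _ _ _).symm
    have hins : ∑ i ∈ I, (1 - q) ^ (T i ∩ insert v U).card = a + (1 - q) * b := by
      rw [← sum_filter_add_sum_filter_not I (fun i => v ∉ T i), ha, hb, mul_sum]
      congr 1
      · refine sum_congr rfl fun i hi => ?_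
        rw [inter_insert_of_notMem (mem_filter.mp hi).2]
      · refine sum_congr rfl fun i hi => ?_
        rw [inter_insert_of_mem (not_not.mp (mem_filter.mp hi).2), card_insert_of_notMem
          (fun h => hv (mem_inter.mp h).2), pow_succ']
    rw [hins, card_insert_of_notMem hv]
    push_cast
    by_cases hcase : 1 + q * U.card + a ≤ q * (U.card + 1) + (a + (1 - q) * b)
    · refine ⟨insert v Γ₁, insert_subset_insert v hΓ₁, ?_⟩
      have hvΓ : v ∉ Γ₁ := fun h => hv (hΓ₁ h)
      have hfil : (I.filter fun i => Disjoint (T i) (insert v Γ₁))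
          = (I.filter fun i => v ∉ T i).filter fun i => Disjoint (T i) Γ₁ := by
        rw [filter_filter]
        exact filter_congr fun i _ => by rw [disjoint_insert_right]
      rw [hfil, card_insert_of_notMem hvΓ]
      push_cast
      linarith
    · refine ⟨Γ₀, hΓ₀.trans (subset_insert v U), ?_⟩
      rw [hab] at hle₀
      -- Since not taking `v` was the better option, `(1 - q) * (1 - b) > 0`.
      have hb1 : 0 < 1 - b :=
        pos_of_mul_pos_right (by linarith : 0 < (1 - q) * (1 - b)) (sub_nonneg.mpr h1)
      linarith [mul_nonneg h0 hb1.le]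

/-- A family of `t`-element sets of columns, one for every row, has a hitting set of at most
`α k` columns as soon as `t` satisfies the condition that defines the sparsity threshold. -/
theorem exists_hittingSet {k t : ℕ} {α : ℝ} (hm : 1 ≤ m) (hn : 1 ≤ n) (ht : 1 ≤ t)
    (T : Fin m → Finset (Fin n)) (hT : ∀ i, (T i).card = t)
    (hα : ∀ x : ℝ, (t : ℝ) ≤ x → (n : ℝ) / x * (1 + Real.log (m * x / n)) ≤ α * k) :
    ∃ Γ : Finset (Fin n), (∀ i, ∃ v ∈ Γ, v ∈ T i) ∧ (Γ.card : ℝ) ≤ α * k := by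
  have hm0 : (0 : ℝ) < m := by exact_mod_cast hm
  have hn0 : (0 : ℝ) < n := by exact_mod_cast hn
  have ht0 : (0 : ℝ) < t := by exact_mod_cast ht
  have hne : ∀ i, (T i).Nonempty := fun i => card_pos.mp (by rw [hT]; omega)
  choose w hw using hne
  by_cases hsmall : (m : ℝ) * t < n
  · -- Few rows: take one neighbour of every row, and the condition at `x = n / m`.
    refine ⟨univ.image w, fun i => ⟨w i, mem_image_of_mem _ (mem_univ i), hw i⟩, ?_⟩
    have h := hα (n / m) (by rw [le_div_iff₀ hm0]; linarith)
    have h2 : (m : ℝ) * (n / m) / n = 1 := by field_simp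
    have h3 : (n : ℝ) / (n / m) = m := by field_simp
    rw [h2, h3, Real.log_one] at h
    have h4 : ((univ.image w).card : ℝ) ≤ m := by
      have := card_image_le (s := univ) (f := w)
      rw [card_univ, Fintype.card_fin] at this
      exact_mod_cast this
    linarith
  push Not at hsmall
  have h := hα t le_rfl
  set ℓ := Real.log (m * t / n) with hℓ
  have hℓ0 : 0 ≤ ℓ := Real.log_nonneg (by rw [le_div_iff₀ hn0]; linarith)
  by_cases hq : ℓ ≤ t
  · obtain ⟨Γ, -, hΓ⟩ := exists_card_add_unhit_le T (q := ℓ / t) (by positivity)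
      ((div_le_one ht0).mpr hq) univ univ
    set R := (univ : Finset (Fin m)).filter fun i => Disjoint (T i) Γ with hR
    refine ⟨Γ ∪ R.image w, fun i => ?_, ?_⟩
    · by_cases hi : Disjoint (T i) Γ
      · exact ⟨w i, mem_union_right _ (mem_image_of_mem _ (mem_filter.mpr ⟨mem_univ i, hi⟩)), hw i⟩
      · obtain ⟨v, hv1, hv2⟩ := not_disjoint_iff.mp hi
        exact ⟨v, mem_union_left _ hv2, hv1⟩
    · have hcard : ((Γ ∪ R.image w).card : ℝ) ≤ Γ.card + R.card := by
        exact_mod_cast (card_union_le _ _).trans (Nat.add_le_add_left card_image_le _)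
      have hmean : ((Γ ∪ R.image w).card : ℝ) ≤ ℓ / t * n + m * Real.exp (-ℓ) := by
        refine (hcard.trans hΓ).trans ?_
        simp only [inter_univ, hT, sum_const, card_univ, Fintype.card_fin, nsmul_eq_mul]
        have : (1 - ℓ / t) ^ t ≤ Real.exp (-ℓ) := Real.one_sub_div_pow_le_exp_neg hq
        have := mul_le_mul_of_nonneg_left this hm0.le
        linarith
      refine (hmean.trans_eq ?_).trans h
      rw [Real.exp_neg, hℓ, Real.exp_log (by positivity)]
      field_simp
      ring
  · -- The bound exceeds the number of columns.
    refine ⟨univ, fun i => ⟨w i, mem_univ _, hw i⟩, ?_⟩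
    rw [card_univ, Fintype.card_fin]
    refine le_trans ?_ h
    rw [div_mul_eq_mul_div, le_div_iff₀ ht0]
    push Not at hq
    nlinarith

/-! ### The loss from sparsification -/

theorem value_sparsify_le {C : Fin m → Fin n → ℝ} (hC : ∀ i v, 0 ≤ C i v)
    (T : Fin m → Finset (Fin n)) (A : Finset (Fin n)) :
    value (sparsify C T) A ≤ value C A := by
  refine sum_le_sum fun i _ => coverage_le (coverage_nonneg C A i) fun v hv => ?_
  refine le_trans ?_ (le_coverage C i hv)
  rw [sparsify]
  split_ifs
  exacts [le_rfl, hC i v]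

/-- A hitting set compensates for the deleted entries: where the best column of `O` is not a
neighbour of a row, the row has a neighbour in the hitting set, which is no worse. -/
theorem value_le_value_sparsify_union {C : Fin m → Fin n → ℝ} {t : ℕ}
    {T : Fin m → Finset (Fin n)} (hT : IsNearestNeighborGraph C t T) (O : Finset (Fin n))
    {Γ : Finset (Fin n)} (hΓ : ∀ i, ∃ v ∈ Γ, v ∈ T i) :
    value C O ≤ value (sparsify C T) (O ∪ Γ) := by
  refine sum_le_sum fun i _ => coverage_le (coverage_nonneg _ _ i) fun o ho => ?_
  by_cases hoT : o ∈ T i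
  · refine le_trans (le_of_eq ?_) (le_coverage _ i (mem_union_left Γ ho))
    rw [sparsify, if_pos hoT]
  · obtain ⟨v, hv, hvT⟩ := hΓ i
    refine le_trans ?_ (le_coverage _ i (mem_union_right O hv))
    rw [sparsify, if_pos hvT]
    exact hT.le_of_mem i v hvT o hoT

theorem exists_opt_eq_value {C : Fin m → Fin n → ℝ} (hC : ∀ i v, 0 ≤ C i v) (k : ℕ) :
    ∃ O : Finset (Fin n), O.card ≤ k ∧ opt C k = value C O := by
  obtain ⟨O, hO, hval⟩ := exists_mem_eq_sup'
    (s := (univ : Finset (Finset (Fin n))).filter fun A => A.card ≤ k) ⟨∅, by simp⟩ (objective C)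
  exact ⟨O, (mem_filter.mp hO).2, hval.trans (objective_eq_value hC O)⟩

/-- Above the threshold, the sparsified problem has a solution with `k` columns whose value is at
least `1 - α` times the optimum of the original problem. -/
theorem exists_value_sparsify_ge {C : Fin m → Fin n → ℝ} (hC : ∀ i v, 0 ≤ C i v) {k t : ℕ}
    {α : ℝ} (hm : 1 ≤ m) (hk : 1 ≤ k) (hkn : k ≤ n) (hα0 : 0 ≤ α) (ht : 1 ≤ t)
    {T : Fin m → Finset (Fin n)} (hT : IsNearestNeighborGraph C t T)
    (hα : ∀ x : ℝ, (t : ℝ) ≤ x → (n : ℝ) / x * (1 + Real.log (m * x / n)) ≤ α * k) :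
    ∃ O : Finset (Fin n), O.card = k ∧ (1 - α) * opt C k ≤ value (sparsify C T) O := by
  obtain ⟨O, hOk, hO⟩ := exists_opt_eq_value hC k
  rw [hO]
  have hpad : ∀ A : Finset (Fin n), A.card ≤ k →
      (1 - α) * value C O ≤ value (sparsify C T) A →
      ∃ A : Finset (Fin n), A.card = k ∧ (1 - α) * value C O ≤ value (sparsify C T) A := by
    intro A hA hle
    obtain ⟨B, hAB, -, hB⟩ := exists_subsuperset_card_eq (subset_univ A) hA (by simpa using hkn)
    exact ⟨B, hB, hle.trans (value_mono _ hAB)⟩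
  by_cases htn : n ≤ t
  · -- Nothing is deleted.
    have hs : sparsify C T = C := by
      funext i v
      have : T i = univ := by
        rw [← card_eq_iff_eq_univ, hT.card_eq, Fintype.card_fin, min_eq_right htn]
      simp [sparsify, this]
    refine hpad O hOk ?_
    rw [hs]
    nlinarith [value_nonneg C O]
  obtain ⟨Γ, hΓ, hΓk⟩ := exists_hittingSet hm (hk.trans hkn) ht T
    (fun i => by rw [hT.card_eq, min_eq_left (by omega)]) hα
  have hle := value_le_value_sparsify_union hT O hΓ
  by_cases hcard : (O ∪ Γ).card ≤ k
  · refine hpad _ hcard ?_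
    nlinarith [value_nonneg C O]
  · obtain ⟨B, -, hBk, hB⟩ := exists_subset_value (sparsify C T) hk (O ∪ Γ) (by omega)
    refine ⟨B, hBk, ?_⟩
    have hk0 : (0 : ℝ) < k := by exact_mod_cast hk
    have hN : ((O ∪ Γ).card : ℝ) ≤ (1 + α) * k := by
      have h1 : ((O ∪ Γ).card : ℝ) ≤ O.card + Γ.card := by exact_mod_cast card_union_le _ _
      have h2 : (O.card : ℝ) ≤ k := by exact_mod_cast hOk
      linarith
    have hB0 := value_nonneg (sparsify C T) B
    have h1 : (k : ℝ) * value C O ≤ k * ((1 + α) * value (sparsify C T) B) := by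
      calc (k : ℝ) * value C O ≤ k * value (sparsify C T) (O ∪ Γ) :=
            mul_le_mul_of_nonneg_left hle hk0.le
        _ ≤ (O ∪ Γ).card * value (sparsify C T) B := hB
        _ ≤ ((1 + α) * k) * value (sparsify C T) B := mul_le_mul_of_nonneg_right hN hB0
        _ = _ := by ring
    have h2 := le_of_mul_le_mul_left h1 hk0
    -- `(1 - α) (1 + α) ≤ 1`
    rcases le_or_gt α 1 with hα1 | hα1
    · nlinarith [mul_le_mul_of_nonneg_left h2 (sub_nonneg.mpr hα1), mul_nonneg (sq_nonneg α) hB0]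
    · nlinarith [value_nonneg C O]

/-! ### The order of magnitude of the threshold -/

/-- In terms of `y = ε k x / n`, the quantity that defines the threshold is
`ε k (1 + log (m / (ε k)) + log y) / y`. -/
theorem threshold_condition_of_le {k : ℕ} {ε x : ℝ} (hm : 1 ≤ m) (hk : 1 ≤ k) (hn : 1 ≤ n)
    (hε : 0 < ε)
    (hx : 12 * (n / (ε * k) * max 1 (Real.log (m / (ε * k)))) ≤ x) :
    (n : ℝ) / x * (1 + Real.log (m * x / n)) ≤ ε / 2 * k := by
  have hm0 : (0 : ℝ) < m := by exact_mod_cast hm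
  have hn0 : (0 : ℝ) < n := by exact_mod_cast hn
  have hk0 : (0 : ℝ) < k := by exact_mod_cast hk
  have hεk : 0 < ε * k := mul_pos hε hk0
  set L := max 1 (Real.log (m / (ε * k))) with hL
  have hL1 : 1 ≤ L := le_max_left _ _
  set y := x * (ε * k) / n with hy
  have hyL : 12 * L ≤ y := by
    rw [hy, le_div_iff₀ hn0]
    calc 12 * L * n = 12 * (n / (ε * k) * L) * (ε * k) := by field_simp
      _ ≤ x * (ε * k) := mul_le_mul_of_nonneg_right hx hεk.le
  have hy0 : 0 < y := by linarith
  have hxy : x = y * n / (ε * k) := by rw [hy]; field_simp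
  have hlog8 : Real.log 8 ≤ 2.1 := by
    have : (8 : ℝ) = 2 ^ 3 := by norm_num
    rw [this, Real.log_pow]
    have := Real.log_two_lt_d9
    push_cast
    linarith
  have hlogy : Real.log y ≤ y / 8 + 1.1 := by
    have h1 : Real.log y = Real.log (y / 8) + Real.log 8 := by
      rw [← Real.log_mul (by positivity) (by norm_num)]; congr 1; ring
    have h2 := Real.log_le_sub_one_of_pos (by positivity : 0 < y / 8)
    linarith
  have hlog : Real.log (m * x / n) ≤ L + Real.log y := by
    have : (m : ℝ) * x / n = m / (ε * k) * y := by rw [hxy]; field_simp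
    rw [this, Real.log_mul (by positivity) (by positivity)]
    linarith [le_max_right 1 (Real.log (m / (ε * k)))]
  have hnx : (n : ℝ) / x = ε * k / y := by rw [hxy]; field_simp
  rw [hnx, div_mul_eq_mul_div, div_le_iff₀ hy0]
  have : 1 + Real.log (m * x / n) ≤ y / 2 := by linarith
  calc ε * k * (1 + Real.log (m * x / n)) ≤ ε * k * (y / 2) :=
        mul_le_mul_of_nonneg_left this hεk.le
    _ = _ := by ring

/-- An explicit element of the set whose infimum is the threshold. -/
theorem ceil_mem_threshold {k : ℕ} {ε : ℝ} (hm : 1 ≤ m) (hk : 1 ≤ k) (hn : 1 ≤ n) (hε : 0 < ε) :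
    ⌈12 * ((n : ℝ) / (ε * k) * max 1 (Real.log (m / (ε * k))))⌉₊ ∈
      {t : ℕ | 1 ≤ t ∧ ∀ x : ℝ, (t : ℝ) ≤ x →
        (n : ℝ) / x * (1 + Real.log (m * x / n)) ≤ ε / 2 * k} := by
  have hn0 : (0 : ℝ) < n := by exact_mod_cast hn
  have hk0 : (0 : ℝ) < k := by exact_mod_cast hk
  have hL : 0 < max 1 (Real.log (m / (ε * k))) := lt_max_of_lt_left one_pos
  refine ⟨Nat.ceil_pos.mpr (by positivity), fun x hx => ?_⟩
  exact threshold_condition_of_le hm hk hn hε ((Nat.le_ceil _).trans hx)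

theorem tStar_le {k : ℕ} {ε : ℝ} (hm : 1 ≤ m) (hk : 1 ≤ k) (hkn : k ≤ n) (hε : 0 < ε)
    (hε1 : ε < 1) :
    (tStar n m k (ε / 2) : ℝ) ≤ 13 * (n / (ε * k) * max 1 (Real.log (m / (ε * k)))) := by
  have hk0 : (0 : ℝ) < k := by exact_mod_cast hk
  have hkn' : (k : ℝ) ≤ n := by exact_mod_cast hkn
  have h1 : (tStar n m k (ε / 2) : ℝ)
      ≤ ⌈12 * ((n : ℝ) / (ε * k) * max 1 (Real.log (m / (ε * k))))⌉₊ :=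
    Nat.cast_le.mpr (Nat.sInf_le (ceil_mem_threshold hm hk (hk.trans hkn) hε))
  have hM : 1 ≤ (n : ℝ) / (ε * k) := by
    rw [le_div_iff₀ (by positivity)]
    nlinarith
  have hML := one_le_mul_of_one_le_of_one_le hM (le_max_left 1 (Real.log (m / (ε * k))))
  have h2 := Nat.ceil_lt_add_one
    (by linarith : 0 ≤ 12 * ((n : ℝ) / (ε * k) * max 1 (Real.log (m / (ε * k)))))
  linarith

/-- Every `t` from the threshold on satisfies the condition that defines it. -/
theorem threshold_condition_of_tStar_le {k t : ℕ} {ε : ℝ} (hm : 1 ≤ m) (hk : 1 ≤ k) (hn : 1 ≤ n)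
    (hε : 0 < ε) (ht : tStar n m k (ε / 2) ≤ t) :
    1 ≤ t ∧ ∀ x : ℝ, (t : ℝ) ≤ x → (n : ℝ) / x * (1 + Real.log (m * x / n)) ≤ ε / 2 * k := by
  obtain ⟨h1, h2⟩ := Nat.sInf_mem ⟨_, ceil_mem_threshold (m := m) (k := k) hm hk hn hε⟩
  exact ⟨h1.trans ht, fun x hx => h2 x (le_trans (Nat.cast_le.mpr ht) hx)⟩

/-! ### The steps of the algorithm -/

theorem Timed.bind_val {α β : Type} (x : Timed α) (f : α → Timed β) :
    (x >>= f).val = (f x.val).val := rfl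

theorem Timed.bind_time {α β : Type} (x : Timed α) (f : α → Timed β) :
    (x >>= f).time = x.time + (f x.val).time := rfl

theorem Timed.pure_time {α : Type} (a : α) : (pure a : Timed α).time = 0 := rfl

theorem step_val {α : Type} (a : α) : (step a).val = a := rfl

theorem step_time {α : Type} (a : α) : (step a).time = 1 := rfl

theorem Timed.foldlM_val {α β : Type} (f : β → α → Timed β) (l : List α) (b : β) :
    (l.foldlM f b).val = l.foldl (fun b a => (f b a).val) b := by
  induction l generalizing b with
  | nil => rfl
  | cons a l ih => rw [List.foldlM_cons]; exact ih _

theorem Timed.foldlM_time_le {α β : Type} (f : β → α → Timed β) (cost : α → ℕ) (l : List α)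
    (h : ∀ a ∈ l, ∀ b, (f b a).time ≤ cost a) (b : β) :
    (l.foldlM f b).time ≤ (l.map cost).sum := by
  induction l generalizing b with
  | nil => exact le_rfl
  | cons a l ih =>
    rw [List.foldlM_cons, Timed.bind_time, List.map_cons, List.sum_cons]
    exact Nat.add_le_add (h a List.mem_cons_self b)
      (ih (fun a' ha' => h a' (List.mem_cons_of_mem a ha')) _)

theorem sum_map_neighbors {M : Type*} [AddCommMonoid M] (T : Fin m → Finset (Fin n)) (v : Fin n)
    (h : Fin m → M) : ((neighbors T v).map h).sum = ∑ i, if v ∈ T i then h i else 0 := by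
  rw [Fin.sum_univ_def, neighbors]
  induction List.finRange m with
  | nil => rfl
  | cons i l ih =>
    by_cases hi : v ∈ T i
    · simp [hi, ih]
    · simp [hi, ih]

theorem mem_neighbors {T : Fin m → Finset (Fin n)} {v : Fin n} {i : Fin m} :
    i ∈ neighbors T v ↔ v ∈ T i := by
  simp [neighbors]

theorem length_neighbors (T : Fin m → Finset (Fin n)) (v : Fin n) :
    (neighbors T v).length = ∑ i, if v ∈ T i then 1 else 0 := by
  rw [← sum_map_neighbors T v (fun _ => 1)]
  simp

theorem length_neighbors_le (T : Fin m → Finset (Fin n)) (v : Fin n) :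
    (neighbors T v).length ≤ m := by
  rw [length_neighbors]
  calc ∑ i : Fin m, (if v ∈ T i then 1 else 0) ≤ ∑ _i : Fin m, 1 :=
        sum_le_sum fun i _ => by split_ifs <;> norm_num
    _ = m := by simp

theorem sum_length_neighbors (T : Fin m → Finset (Fin n)) :
    ∑ v, (neighbors T v).length = ∑ i, (T i).card := by
  simp only [length_neighbors]
  rw [sum_comm]
  simp

theorem gain_val (C : Fin m → Fin n → ℝ) (T : Fin m → Finset (Fin n)) {β : Fin m → ℝ}
    (hβ : ∀ i, 0 ≤ β i) (v : Fin n) :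
    (gain (sparsify C T) T β v).val = ∑ i, max (sparsify C T i v - β i) 0 := by
  have h1 : (gain (sparsify C T) T β v).val
      = ((neighbors T v).map fun i => max (sparsify C T i v - β i) 0).sum := by
    rw [gain, Timed.foldlM_val, List.sum_eq_foldl, List.foldl_map]
    rfl
  rw [h1, sum_map_neighbors]
  refine sum_congr rfl fun i _ => ?_
  split_ifs with h
  · rfl
  · rw [sparsify, if_neg h, zero_sub, max_eq_right (neg_nonpos.mpr (hβ i))]

theorem gain_time_le (C : Fin m → Fin n → ℝ) (T : Fin m → Finset (Fin n)) (β : Fin m → ℝ)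
    (v : Fin n) : (gain C T β v).time ≤ 6 * (neighbors T v).length := by
  refine (Timed.foldlM_time_le _ (fun _ => 6) _ (fun _ _ _ => le_rfl) _).trans ?_
  simp [mul_comm]

theorem updateCache_val (C : Fin m → Fin n → ℝ) (T : Fin m → Finset (Fin n)) {β : Fin m → ℝ}
    (hβ : ∀ i, 0 ≤ β i) (v : Fin n) (i : Fin m) :
    (updateCache (sparsify C T) T v β).val i = max (β i) (sparsify C T i v) := by
  have h1 : ∀ (l : List (Fin m)) (β : Fin m → ℝ),
      l.foldl (fun β i => Function.update β i (max (β i) (sparsify C T i v))) β i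
        = if i ∈ l then max (β i) (sparsify C T i v) else β i := by
    intro l
    induction l with
    | nil => intro β; simp
    | cons j l ih =>
      intro β
      rw [List.foldl_cons, ih]
      by_cases hij : i = j
      · subst hij; simp
      · simp [hij]
  have h2 := h1 (neighbors T v) β
  rw [updateCache, Timed.foldlM_val]
  refine h2.trans ?_
  split_ifs with h
  · rfl
  · rw [sparsify, if_neg (fun h' => h (mem_neighbors.mpr h')), max_eq_left (hβ i)]

theorem updateCache_time_le (C : Fin m → Fin n → ℝ) (T : Fin m → Finset (Fin n)) (β : Fin m → ℝ)
    (v : Fin n) : (updateCache C T v β).time ≤ 5 * (neighbors T v).length := by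
  refine (Timed.foldlM_time_le _ (fun _ => 5) _ (fun _ _ _ => le_rfl) _).trans ?_
  simp [mul_comm]

theorem bestOf_time_le (C : Fin m → Fin n → ℝ) (T : Fin m → Finset (Fin n))
    (tie : Fin n → Fin n → Bool) (β : Fin m → ℝ) (l : List (Fin n)) :
    (bestOf C T tie β l).time ≤ (l.map fun v => 5 + 6 * (neighbors T v).length).sum := by
  refine Timed.foldlM_time_le _ _ _ (fun v _ best => ?_) _
  have := gain_time_le C T β v
  rcases best with _ | ⟨u, h⟩
  · simp only [Timed.bind_time, step_time, step_val]
    omega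
  · simp only [Timed.bind_time, step_time, step_val]
    omega

theorem bestOf_val (C : Fin m → Fin n → ℝ) (T : Fin m → Finset (Fin n))
    (tie : Fin n → Fin n → Bool) (β : Fin m → ℝ) {l : List (Fin n)} (hl : l ≠ []) :
    ∃ v ∈ l, ∃ g, (bestOf C T tie β l).val = some (v, g) ∧
      ∀ w ∈ l, (gain C T β w).val ≤ (gain C T β v).val := by
  have key : ∀ (F : Option (Fin n × ℝ) → Fin n → Option (Fin n × ℝ)),
      (∀ u h w, F (some (u, h)) w =
        if h < (gain C T β w).val ∨ (h = (gain C T β w).val ∧ tie w u = true)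
        then some (w, (gain C T β w).val) else some (u, h)) →
      ∀ (l : List (Fin n)) (u : Fin n), ∃ v, (v = u ∨ v ∈ l) ∧
        l.foldl F (some (u, (gain C T β u).val)) = some (v, (gain C T β v).val) ∧
        (gain C T β u).val ≤ (gain C T β v).val ∧
        ∀ w ∈ l, (gain C T β w).val ≤ (gain C T β v).val := by
    intro F hF l
    induction l with
    | nil => intro u; exact ⟨u, Or.inl rfl, rfl, le_rfl, by simp⟩
    | cons a l ih =>
      intro u
      rw [List.foldl_cons, hF]
      split_ifs with h
      · obtain ⟨v, hv, he, hle, hall⟩ := ih a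
        have hua : (gain C T β u).val ≤ (gain C T β a).val := by
          rcases h with h | h
          exacts [h.le, h.1.le]
        refine ⟨v, Or.inr ?_, he, hua.trans hle, ?_⟩
        · rcases hv with rfl | hv
          exacts [List.mem_cons_self, List.mem_cons_of_mem a hv]
        · intro w hw
          rcases List.mem_cons.mp hw with rfl | hw
          exacts [hle, hall w hw]
      · obtain ⟨v, hv, he, hle, hall⟩ := ih u
        refine ⟨v, ?_, he, hle, ?_⟩
        · rcases hv with rfl | hv
          exacts [Or.inl rfl, Or.inr (List.mem_cons_of_mem a hv)]
        · intro w hw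
          rcases List.mem_cons.mp hw with rfl | hw
          · exact (not_lt.mp fun h' => h (Or.inl h')).trans hle
          · exact hall w hw
  cases l with
  | nil => exact absurd rfl hl
  | cons a l =>
    rw [bestOf, Timed.foldlM_val, List.foldl_cons]
    obtain ⟨v, hv, he, hle, hall⟩ := key (fun best v => Timed.val (do
      let v ← step v
      let g ← gain C T β v
      match best with
      | none => step (some (v, g))
      | some (u, h) => do
        let larger ← step (decide (h < g))
        let equal ← step (decide (h = g))
        let preferred ← step (tie v u)
        step (if larger = true ∨ (equal = true ∧ preferred = true) then some (v, g)
          else some (u, h)))) (fun u h w => by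
            simp only [Timed.bind_val, step_val, decide_eq_true_eq]
            congr) l a
    refine ⟨v, List.mem_cons.mpr hv, (gain C T β v).val, he, fun w hw => ?_⟩
    rcases List.mem_cons.mp hw with rfl | hw
    exacts [hle, hall w hw]

theorem iteration_val (C : Fin m → Fin n → ℝ) (T : Fin m → Finset (Fin n))
    (tie : Fin n → Fin n → Bool) (σ : (Fin m → ℝ) × List (Fin n)) {l : List (Fin n)}
    (hl : l ≠ []) :
    ∃ v ∈ l, (iteration C T tie σ l).val = ((updateCache C T v σ.1).val, v :: σ.2) ∧
      ∀ w ∈ l, (gain C T σ.1 w).val ≤ (gain C T σ.1 v).val := by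
  obtain ⟨v, hv, g, he, hall⟩ := bestOf_val C T tie σ.1 hl
  refine ⟨v, hv, ?_, hall⟩
  rw [iteration, Timed.bind_val, he]
  rfl

theorem iteration_time_le (C : Fin m → Fin n → ℝ) (T : Fin m → Finset (Fin n))
    (tie : Fin n → Fin n → Bool) (σ : (Fin m → ℝ) × List (Fin n)) (l : List (Fin n)) :
    (iteration C T tie σ l).time ≤
      2 + (l.map fun v => 5 + 11 * (neighbors T v).length).sum := by
  by_cases hl : l = []
  · subst hl
    exact (by decide : 1 ≤ 2)
  · obtain ⟨v, hv, g, he, -⟩ := bestOf_val C T tie σ.1 hl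
    have h1 := bestOf_time_le C T tie σ.1 l
    have h2 := updateCache_time_le C T σ.1 v
    have h3 : 5 * (neighbors T v).length ≤ (l.map fun v => 5 * (neighbors T v).length).sum :=
      List.single_le_sum (by simp) _ (List.mem_map_of_mem hv)
    have h4 : (l.map fun v => 5 + 11 * (neighbors T v).length).sum
        = (l.map fun v => 5 + 6 * (neighbors T v).length).sum
          + (l.map fun v => 5 * (neighbors T v).length).sum := by
      rw [← List.sum_map_add]
      congr 1
      refine List.map_congr_left fun v _ => ?_
      ring
    rw [iteration, Timed.bind_time, he]
    simp only [Timed.bind_time, step_time, step_val]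
    omega

theorem initCache_val : (initCache m fun _ => 0).val = fun _ => 0 := by
  rw [initCache, Timed.foldlM_val]
  have : ∀ l : List (Fin m),
      l.foldl (fun (β : Fin m → ℝ) i => Function.update β i 0) (fun _ => 0) = fun _ => 0 := by
    intro l
    induction l with
    | nil => rfl
    | cons i l ih =>
      rw [List.foldl_cons]
      have : Function.update (fun _ : Fin m => (0 : ℝ)) i 0 = fun _ => 0 :=
        Function.update_eq_self i _
      rw [this, ih]
  exact this _

theorem initCache_time_le (β : Fin m → ℝ) : (initCache m β).time ≤ 2 * m := by
  refine (Timed.foldlM_time_le _ (fun _ => 2) _ (fun _ _ _ => le_rfl) _).trans ?_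
  simp [mul_comm]

/-- The running time is linear in the number of rows, the number of draws, and the total degree of
the drawn columns. -/
theorem runningTime_le {k s : ℕ} (C : Fin m → Fin n → ℝ) (T : Fin m → Finset (Fin n))
    (tie : Fin n → Fin n → Bool) (ω : Samples n k s) :
    runningTime C T tie ω ≤
      2 * m + k * (3 + 5 * s) + 11 * ∑ j, ∑ i, (neighbors T (ω j i)).length := by
  have h1 := initCache_time_le (fun _ : Fin m => (0 : ℝ))
  have h2 := Timed.foldlM_time_le (fun state j => do
      let j ← step j
      iteration C T tie state (List.ofFn (ω j)))
    (fun j => 3 + ∑ i, (5 + 11 * (neighbors T (ω j i)).length)) (List.finRange k) (by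
      intro j _ σ
      have := iteration_time_le C T tie σ (List.ofFn (ω j))
      rw [List.map_ofFn, List.sum_ofFn] at this
      simp only [Timed.bind_time, step_time, step_val]
      simp only [Function.comp_apply] at this
      omega) ((initCache m fun _ => 0).val, [])
  rw [← Fin.sum_univ_def] at h2
  have h3 : ∑ j : Fin k, (3 + ∑ i, (5 + 11 * (neighbors T (ω j i)).length))
      = k * (3 + 5 * s) + 11 * ∑ j, ∑ i, (neighbors T (ω j i)).length := by
    simp only [sum_add_distrib, sum_const, card_univ, Fintype.card_fin, smul_eq_mul, ← mul_sum]
    ring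
  rw [h3] at h2
  rw [runningTime, stochasticGreedy]
  simp only [Timed.bind_time, Timed.pure_time]
  omega

/-! ### The expected value of the greedy solution -/

/-- The state of the algorithm after the iterations with the samples `ω`, from the state `σ`. -/
def run {K s : ℕ} (C : Fin m → Fin n → ℝ) (T : Fin m → Finset (Fin n))
    (tie : Fin n → Fin n → Bool) (σ : (Fin m → ℝ) × List (Fin n)) (ω : Samples n K s) :
    (Fin m → ℝ) × List (Fin n) :=
  (List.finRange K).foldl (fun σ j => (iteration C T tie σ (List.ofFn (ω j))).val) σ

theorem run_cons {K s : ℕ} (C : Fin m → Fin n → ℝ) (T : Fin m → Finset (Fin n))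
    (tie : Fin n → Fin n → Bool) (σ : (Fin m → ℝ) × List (Fin n)) (f : Fin s ↪ Fin n)
    (ω : Samples n K s) :
    run C T tie σ (Fin.cons f ω : Samples n (K + 1) s) =
      run C T tie (iteration C T tie σ (List.ofFn f)).val ω := by
  rw [run, List.finRange_succ, List.foldl_cons, List.foldl_map]
  rfl

theorem selected_eq_run {k s : ℕ} (C : Fin m → Fin n → ℝ) (T : Fin m → Finset (Fin n))
    (tie : Fin n → Fin n → Bool) (ω : Samples n k s) :
    selected C T tie ω = (run C T tie (fun _ => 0, []) ω).2.toFinset := by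
  rw [selected, stochasticGreedy, Timed.bind_val, Timed.bind_val, initCache_val,
    Timed.foldlM_val]
  rfl

/-- In every iteration the cache holds the benefits from the columns selected so far, and the
value grows by the gain of the selected column, which is the largest gain in the sample. -/
theorem iteration_spec (C : Fin m → Fin n → ℝ) (T : Fin m → Finset (Fin n))
    (tie : Fin n → Fin n → Bool) {σ : (Fin m → ℝ) × List (Fin n)}
    (hσ : σ.1 = coverage (sparsify C T) σ.2.toFinset) {l : List (Fin n)} (hl : l ≠ []) :
    (iteration (sparsify C T) T tie σ l).val.1 =
        coverage (sparsify C T) (iteration (sparsify C T) T tie σ l).val.2.toFinset ∧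
      ∀ w ∈ l, ∑ i, max (sparsify C T i w - σ.1 i) 0 ≤
        value (sparsify C T) (iteration (sparsify C T) T tie σ l).val.2.toFinset -
          value (sparsify C T) σ.2.toFinset := by
  have hβ : ∀ i, 0 ≤ σ.1 i := fun i => by rw [hσ]; exact coverage_nonneg _ _ i
  obtain ⟨v, -, he, hall⟩ := iteration_val (sparsify C T) T tie σ hl
  rw [he]
  refine ⟨?_, fun w hw => ?_⟩
  · funext i
    change (updateCache (sparsify C T) T v σ.1).val i = _
    rw [List.toFinset_cons, coverage_insert, updateCache_val C T hβ, hσ]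
  · have h := hall w hw
    rw [gain_val C T hβ, gain_val C T hβ] at h
    refine h.trans (le_of_eq ?_)
    rw [value, value, ← sum_sub_distrib]
    refine sum_congr rfl fun i _ => ?_
    rw [List.toFinset_cons, coverage_insert, hσ]
    rcases le_total (coverage (sparsify C T) σ.2.toFinset i) (sparsify C T i v) with h | h
    · rw [max_eq_left (sub_nonneg.mpr h), max_eq_right h]
    · rw [max_eq_right (sub_nonpos.mpr h), max_eq_left h, sub_self]

/-- If a sample meets the set `O` of `k` columns with probability at least `p`, one iteration
reduces the gap to the value of `O` to at most `1 - p / k` times its size, in the mean. -/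
theorem sum_gap_iteration_le {k s : ℕ} (C : Fin m → Fin n → ℝ) (T : Fin m → Finset (Fin n))
    (tie : Fin n → Fin n → Bool) (hs : 1 ≤ s) (hk : 1 ≤ k) {O : Finset (Fin n)}
    (hO : O.card = k) {p : ℝ}
    (hp : p * Fintype.card (Fin s ↪ Fin n) ≤
      ((univ.filter fun f : Fin s ↪ Fin n => ∃ i, f i ∈ O).card : ℝ))
    {σ : (Fin m → ℝ) × List (Fin n)} (hσ : σ.1 = coverage (sparsify C T) σ.2.toFinset)
    (hp0 : 0 ≤ p) :
    ∑ f : Fin s ↪ Fin n, (value (sparsify C T) O - value (sparsify C T)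
        (iteration (sparsify C T) T tie σ (List.ofFn f)).val.2.toFinset) ≤
      Fintype.card (Fin s ↪ Fin n) * ((1 - p / k) *
        (value (sparsify C T) O - value (sparsify C T) σ.2.toFinset)) := by
  have hk0 : (0 : ℝ) < k := by exact_mod_cast hk
  have hβ : ∀ i, 0 ≤ σ.1 i := fun i => by rw [hσ]; exact coverage_nonneg _ _ i
  set d : Fin n → ℝ := fun w => ∑ i, max (sparsify C T i w - σ.1 i) 0 with hd
  have hd0 : ∀ w, 0 ≤ d w := fun w => sum_nonneg fun i _ => le_max_right _ _
  set V := value (sparsify C T) σ.2.toFinset with hV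
  set M : (Fin s ↪ Fin n) → ℝ := fun f => value (sparsify C T)
    (iteration (sparsify C T) T tie σ (List.ofFn f)).val.2.toFinset - V with hMdef
  have hne : ∀ f : Fin s ↪ Fin n, List.ofFn f ≠ [] := fun f h => by
    rw [List.ofFn_eq_nil_iff] at h; omega
  have hM : ∀ f i, d (f i) ≤ M f := fun f i =>
    (iteration_spec C T tie hσ (hne f)).2 (f i) ((List.mem_ofFn' _ _).mpr ⟨i, rfl⟩)
  have hM0 : ∀ f, 0 ≤ M f := fun f => (hd0 _).trans (hM f ⟨0, hs⟩)
  have hN0 : (0 : ℝ) ≤ Fintype.card (Fin s ↪ Fin n) := Nat.cast_nonneg _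
  generalize hN : (Fintype.card (Fin s ↪ Fin n) : ℝ) = N at hp hN0 ⊢
  have h1 := sum_embedding_hit_le O d s M hM0 hM
  rw [hO] at h1
  have hVβ : V = ∑ i, σ.1 i := by rw [hV, hσ]; rfl
  have h2 : value (sparsify C T) O - V ≤ ∑ o ∈ O, d o := by
    rw [hVβ]
    exact value_sub_le_sum_gain (sparsify C T) O hβ
  have h3 : p * N * (value (sparsify C T) O - V) ≤ k * ∑ f, M f := by
    calc p * N * (value (sparsify C T) O - V)
        ≤ p * N * ∑ o ∈ O, d o :=
          mul_le_mul_of_nonneg_left h2 (mul_nonneg hp0 hN0)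
      _ ≤ _ := mul_le_mul_of_nonneg_right hp (sum_nonneg fun o _ => hd0 o)
      _ ≤ _ := h1
  have h4 : p / k * N * (value (sparsify C T) O - V) ≤ ∑ f, M f := by
    refine le_of_mul_le_mul_left (le_of_eq_of_le ?_ h3) hk0
    field_simp
  have h5 : ∀ f : Fin s ↪ Fin n, value (sparsify C T) O - value (sparsify C T)
      (iteration (sparsify C T) T tie σ (List.ofFn f)).val.2.toFinset
      = (value (sparsify C T) O - V) - M f := fun f => by simp only [hMdef]; ring
  simp only [h5]
  rw [sum_sub_distrib, sum_const, card_univ, nsmul_eq_mul, hN]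
  linarith

/-- After `K` iterations from any state with a correct cache, the mean gap to the value of `O` has
shrunk by `(1 - p / k) ^ K`. -/
theorem sum_gap_run_le {k s : ℕ} (C : Fin m → Fin n → ℝ) (T : Fin m → Finset (Fin n))
    (tie : Fin n → Fin n → Bool) (hs : 1 ≤ s) (hk : 1 ≤ k) {O : Finset (Fin n)}
    (hO : O.card = k) {p : ℝ} (hp0 : 0 ≤ p) (hp1 : p ≤ 1)
    (hp : p * Fintype.card (Fin s ↪ Fin n) ≤
      ((univ.filter fun f : Fin s ↪ Fin n => ∃ i, f i ∈ O).card : ℝ)) (K : ℕ) :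
    ∀ σ : (Fin m → ℝ) × List (Fin n), σ.1 = coverage (sparsify C T) σ.2.toFinset →
    ∑ ω : Samples n K s, (value (sparsify C T) O - value (sparsify C T)
        (run (sparsify C T) T tie σ ω).2.toFinset) ≤
      Fintype.card (Samples n K s) * ((1 - p / k) ^ K *
        (value (sparsify C T) O - value (sparsify C T) σ.2.toFinset)) := by
  have hk1 : (1 : ℝ) ≤ k := by exact_mod_cast hk
  have hq : 0 ≤ 1 - p / k := by
    rw [sub_nonneg, div_le_one (by linarith)]; linarith
  induction K with
  | zero =>
    intro σ _
    simp [run]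
  | succ K ih =>
    intro σ hσ
    rw [← (Fin.consEquiv fun _ => Fin s ↪ Fin n).sum_comp, Fintype.sum_prod_type]
    have hne : ∀ f : Fin s ↪ Fin n, List.ofFn f ≠ [] := fun f h => by
      rw [List.ofFn_eq_nil_iff] at h; omega
    calc ∑ f : Fin s ↪ Fin n, ∑ ω : Samples n K s, (value (sparsify C T) O -
          value (sparsify C T)
            (run (sparsify C T) T tie σ (Fin.cons f ω : Samples n (K + 1) s)).2.toFinset)
        ≤ ∑ f : Fin s ↪ Fin n, Fintype.card (Samples n K s) * ((1 - p / k) ^ K *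
            (value (sparsify C T) O - value (sparsify C T)
              (iteration (sparsify C T) T tie σ (List.ofFn f)).val.2.toFinset)) := by
          refine sum_le_sum fun f _ => ?_
          simp only [run_cons]
          exact ih _ (iteration_spec C T tie hσ (hne f)).1
      _ = Fintype.card (Samples n K s) * (1 - p / k) ^ K *
            ∑ f : Fin s ↪ Fin n, (value (sparsify C T) O - value (sparsify C T)
              (iteration (sparsify C T) T tie σ (List.ofFn f)).val.2.toFinset) := by
          rw [mul_sum]
          exact sum_congr rfl fun f _ => by ring
      _ ≤ Fintype.card (Samples n K s) * (1 - p / k) ^ K *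
            (Fintype.card (Fin s ↪ Fin n) * ((1 - p / k) *
              (value (sparsify C T) O - value (sparsify C T) σ.2.toFinset))) :=
          mul_le_mul_of_nonneg_left (sum_gap_iteration_le C T tie hs hk hO hp hσ hp0)
            (by positivity)
      _ = _ := by
          have : Fintype.card (Samples n (K + 1) s)
              = Fintype.card (Samples n K s) * Fintype.card (Fin s ↪ Fin n) := by
            simp only [Fintype.card_pi, prod_const, card_univ, Fintype.card_fin, pow_succ]
          rw [this]
          push_cast
          ring

theorem half_le_log_two_div {ε : ℝ} (hε : 0 < ε) (hε1 : ε < 1) : 1 / 2 ≤ Real.log (2 / ε) := by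
  have h1 : Real.log 2 ≤ Real.log (2 / ε) :=
    Real.log_le_log (by norm_num) (by rw [le_div_iff₀ hε]; linarith)
  linarith [Real.log_two_gt_d9]

theorem sampleSize_le (n k : ℕ) (ε : ℝ) : sampleSize n k ε ≤ n := min_le_left _ _

theorem one_le_sampleSize {k : ℕ} {ε : ℝ} (hk : 1 ≤ k) (hkn : k ≤ n) (hε : 0 < ε)
    (hε1 : ε < 1) : 1 ≤ sampleSize n k ε := by
  refine le_min (hk.trans hkn) (Nat.ceil_pos.mpr ?_)
  have h1 : (0 : ℝ) < n := by exact_mod_cast hk.trans hkn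
  have h2 : (0 : ℝ) < k := by exact_mod_cast hk
  have := half_le_log_two_div hε hε1
  exact mul_pos (div_pos h1 h2) (by linarith)

theorem card_samples_pos {k s : ℕ} (hs : s ≤ n) : 0 < Fintype.card (Samples n k s) :=
  Fintype.card_pos_iff.mpr ⟨fun _ => Fin.castLEEmb hs⟩

/-- With the sample size of the algorithm, a sample meets a set of `k` columns with probability at
least `1 - ε / 2`. -/
theorem le_card_embedding_hit {k : ℕ} {ε : ℝ} (hk : 1 ≤ k) (hkn : k ≤ n) (hε : 0 < ε)
    {O : Finset (Fin n)} (hO : O.card = k) :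
    (1 - ε / 2) * Fintype.card (Fin (sampleSize n k ε) ↪ Fin n) ≤
      ((univ.filter fun f : Fin (sampleSize n k ε) ↪ Fin n => ∃ i, f i ∈ O).card : ℝ) := by
  have hn0 : (0 : ℝ) < n := by exact_mod_cast hk.trans hkn
  have hk0 : (0 : ℝ) < k := by exact_mod_cast hk
  have hkn' : (k : ℝ) ≤ n := by exact_mod_cast hkn
  have : Nonempty (Fin n) := ⟨⟨0, hk.trans hkn⟩⟩
  have hcompl : ((univ.filter fun f : Fin (sampleSize n k ε) ↪ Fin n => ∃ i, f i ∈ O).card : ℝ)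
      + ((univ.filter fun f : Fin (sampleSize n k ε) ↪ Fin n => ∀ i, f i ∉ O).card : ℝ)
      = Fintype.card (Fin (sampleSize n k ε) ↪ Fin n) := by
    have h := card_filter_add_card_filter_not
      (s := (univ : Finset (Fin (sampleSize n k ε) ↪ Fin n))) (fun f => ∃ i, f i ∈ O)
    simp only [not_exists] at h
    rw [card_univ] at h
    exact_mod_cast h
  have hmiss : ((univ.filter fun f : Fin (sampleSize n k ε) ↪ Fin n => ∀ i, f i ∉ O).card : ℝ)
      ≤ Fintype.card (Fin (sampleSize n k ε) ↪ Fin n) * (ε / 2) := by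
    by_cases hs : sampleSize n k ε = n
    · -- A sample of all columns meets `O` surely.
      rw [filter_eq_empty_iff.mpr]
      · rw [card_empty, Nat.cast_zero]
        positivity
      · intro f _ hf
        obtain ⟨o, ho⟩ := card_pos.mp (by omega : 0 < O.card)
        have hbij := (Fintype.bijective_iff_injective_and_card f).mpr
          ⟨f.injective, by rw [Fintype.card_fin, Fintype.card_fin, hs]⟩
        obtain ⟨i, rfl⟩ := hbij.2 o
        exact hf i ho
    · refine (card_embedding_disjoint_le O _).trans
        (mul_le_mul_of_nonneg_left ?_ (Nat.cast_nonneg _))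
      rw [hO, Fintype.card_fin]
      have hle : (n : ℝ) / k * Real.log (2 / ε) ≤ sampleSize n k ε := by
        have : sampleSize n k ε = ⌈(n : ℝ) / k * Real.log (2 / ε)⌉₊ :=
          (min_choice _ _).resolve_left hs
        rw [this]
        exact Nat.le_ceil _
      calc (1 - (k : ℝ) / n) ^ sampleSize n k ε
          ≤ Real.exp (-(k / n)) ^ sampleSize n k ε :=
            pow_le_pow_left₀ (sub_nonneg.mpr ((div_le_one hn0).mpr hkn'))
              (Real.one_sub_le_exp_neg _) _
        _ = Real.exp (-(sampleSize n k ε * (k / n))) := by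
            rw [← Real.exp_nat_mul]; congr 1; ring
        _ ≤ Real.exp (-Real.log (2 / ε)) := by
            refine Real.exp_le_exp.mpr (neg_le_neg ?_)
            calc Real.log (2 / ε) = n / k * Real.log (2 / ε) * (k / n) := by field_simp
              _ ≤ _ := mul_le_mul_of_nonneg_right hle (by positivity)
        _ = ε / 2 := by
            rw [Real.exp_neg, Real.exp_log (by positivity), inv_div]
  linarith

theorem exp_neg_one_sub_le {δ : ℝ} (h0 : 0 ≤ δ) (h1 : δ ≤ 1) :
    Real.exp (-(1 - δ)) ≤ 1 / Real.exp 1 + δ := by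
  have h := convexOn_exp.2 (Set.mem_univ (-1)) (Set.mem_univ 0) (sub_nonneg.mpr h1) h0
    (by ring)
  simp only [smul_eq_mul, mul_zero, add_zero, Real.exp_zero, mul_one, mul_neg] at h
  have h2 : 0 < Real.exp (-1) := Real.exp_pos _
  rw [one_div, ← Real.exp_neg]
  nlinarith

/-- On the sparsified problem, the mean value of the greedy solution is at least `1 - 1/e - ε/2`
times the value of any `k` columns. -/
theorem le_sum_value_selected {k : ℕ} {ε : ℝ} (C : Fin m → Fin n → ℝ)
    (T : Fin m → Finset (Fin n)) (tie : Fin n → Fin n → Bool) (hk : 1 ≤ k) (hkn : k ≤ n)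
    (hε : 0 < ε) (hε1 : ε < 1) {O : Finset (Fin n)} (hO : O.card = k) :
    Fintype.card (Samples n k (sampleSize n k ε)) *
        ((1 - 1 / Real.exp 1 - ε / 2) * value (sparsify C T) O) ≤
      ∑ ω : Samples n k (sampleSize n k ε),
        value (sparsify C T) (selected (sparsify C T) T tie ω) := by
  have h := sum_gap_run_le C T tie (one_le_sampleSize hk hkn hε hε1) hk hO
    (p := 1 - ε / 2) (by linarith) (by linarith) (le_card_embedding_hit hk hkn hε hO) k
    (fun _ => 0, []) (by funext i; simp [coverage])
  simp only [← selected_eq_run] at h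
  rw [sum_sub_distrib, sum_const, card_univ, nsmul_eq_mul] at h
  have hempty : value (sparsify C T) (([] : List (Fin n)).toFinset) = 0 := by
    simp [value, coverage]
  rw [hempty, sub_zero] at h
  have hpow : (1 - (1 - ε / 2) / (k : ℝ)) ^ k ≤ 1 / Real.exp 1 + ε / 2 := by
    refine (Real.one_sub_div_pow_le_exp_neg ?_).trans
      (exp_neg_one_sub_le (by linarith) (by linarith))
    have : (1 : ℝ) ≤ k := by exact_mod_cast hk
    linarith
  have h2 := mul_le_mul_of_nonneg_left
    (mul_le_mul_of_nonneg_right hpow (value_nonneg (sparsify C T) O))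
    (Nat.cast_nonneg (α := ℝ) (Fintype.card (Samples n k (sampleSize n k ε))))
  linarith

theorem approximation_guarantee {k t : ℕ} {ε : ℝ} {C : Fin m → Fin n → ℝ}
    {T : Fin m → Finset (Fin n)} (tie : Fin n → Fin n → Bool) (hm : 1 ≤ m) (hk : 1 ≤ k)
    (hkn : k ≤ n) (hε : 0 < ε) (hε1 : ε < 1) (hC : ∀ i v, 0 ≤ C i v)
    (ht : tStar n m k (ε / 2) ≤ t) (hT : IsNearestNeighborGraph C t T) :
    (1 - 1 / Real.exp 1 - ε) * opt C k ≤
      expectation fun ω : Samples n k (sampleSize n k ε) =>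
        objective C (selected (sparsify C T) T tie ω) := by
  obtain ⟨ht1, hα⟩ := threshold_condition_of_tStar_le hm hk (hk.trans hkn) hε ht
  obtain ⟨O, hO, hle⟩ := exists_value_sparsify_ge hC hm hk hkn (by linarith) ht1 hT hα
  have h := le_sum_value_selected C T tie hk hkn hε hε1 hO
  have hcard : (0 : ℝ) < Fintype.card (Samples n k (sampleSize n k ε)) := by
    exact_mod_cast card_samples_pos (sampleSize_le n k ε)
  have hopt : 0 ≤ opt C k := by
    obtain ⟨A, -, hA⟩ := exists_opt_eq_value hC k
    rw [hA]
    exact value_nonneg C A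
  have hexp : 1 / Real.exp 1 ≤ 1 / 2 :=
    one_div_le_one_div_of_le (by norm_num) (by linarith [Real.exp_one_gt_d9])
  have hexp0 : 0 ≤ 1 / Real.exp 1 := by positivity
  rw [expectation, le_div_iff₀ hcard]
  calc (1 - 1 / Real.exp 1 - ε) * opt C k * Fintype.card (Samples n k (sampleSize n k ε))
      ≤ Fintype.card (Samples n k (sampleSize n k ε)) *
          ((1 - 1 / Real.exp 1 - ε / 2) * value (sparsify C T) O) := by
        rw [mul_comm]
        refine mul_le_mul_of_nonneg_left ?_ hcard.le
        have h1 := mul_le_mul_of_nonneg_left hle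
          (by linarith : 0 ≤ 1 - 1 / Real.exp 1 - ε / 2)
        have h2 : 0 ≤ ε / 2 * (1 / Real.exp 1 + ε / 2) * opt C k := by positivity
        linarith
    _ ≤ _ := h
    _ ≤ _ := by
        refine sum_le_sum fun ω _ => ?_
        rw [objective_eq_value hC]
        exact value_sparsify_le hC T _

/-! ### The tail of the running time -/

theorem exp_half_le_one_add {x : ℝ} (h0 : 0 ≤ x) (h1 : x ≤ 1) : Real.exp (x / 2) ≤ 1 + x := by
  have h2 := Real.one_sub_le_exp_neg (x / 2)
  have h3 : Real.exp (x / 2) * Real.exp (-(x / 2)) = 1 := by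
    rw [← Real.exp_add, add_neg_cancel, Real.exp_zero]
  have h4 : 1 ≤ (1 + x) * (1 - x / 2) := by nlinarith
  have h5 := Real.exp_pos (x / 2)
  have h6 : Real.exp (x / 2) * (1 - x / 2) ≤ 1 := by
    exact (mul_le_mul_of_nonneg_left h2 h5.le).trans_eq h3
  refine le_of_mul_le_mul_right (h6.trans h4) (by linarith)

/-- Chernoff bound for the total weight of `k` independent uniform samples of size `s`, for weights
in `[0, 1]`. -/
theorem card_weight_gt_le {k s : ℕ} (hn : 1 ≤ n) (x : Fin n → ℝ) (h0 : ∀ v, 0 ≤ x v)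
    (h1 : ∀ v, x v ≤ 1) (τ : ℝ) :
    ((univ.filter fun ω : Samples n k s => τ < ∑ j, ∑ i, x (ω j i)).card : ℝ) ≤
      Fintype.card (Samples n k s) * Real.exp (2 * (k * s) * (∑ v, x v) / n - τ / 2) := by
  have : Nonempty (Fin n) := ⟨⟨0, hn⟩⟩
  have hprod : ∀ ω : Samples n k s, 0 ≤ ∏ j, ∏ i, (1 + x (ω j i)) := fun ω =>
    prod_nonneg fun j _ => prod_nonneg fun i _ => by linarith [h0 (ω j i)]
  have hmarkov : ∀ ω : Samples n k s, (if τ < ∑ j, ∑ i, x (ω j i) then (1 : ℝ) else 0) ≤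
      Real.exp (-(τ / 2)) * ∏ j, ∏ i, (1 + x (ω j i)) := by
    intro ω
    split_ifs with hω
    · calc (1 : ℝ) ≤ Real.exp (-(τ / 2)) * Real.exp ((∑ j, ∑ i, x (ω j i)) / 2) := by
            rw [← Real.exp_add]
            exact Real.one_le_exp (by linarith)
        _ = Real.exp (-(τ / 2)) * ∏ j, ∏ i, Real.exp (x (ω j i) / 2) := by
            simp only [← Real.exp_sum, sum_div]
        _ ≤ _ := by
            refine mul_le_mul_of_nonneg_left ?_ (Real.exp_pos _).le
            exact prod_le_prod (fun j _ => prod_nonneg fun i _ => (Real.exp_pos _).le)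
              fun j _ => prod_le_prod (fun i _ => (Real.exp_pos _).le)
                fun i _ => exp_half_le_one_add (h0 _) (h1 _)
    · exact mul_nonneg (Real.exp_pos _).le (hprod ω)
  rw [← sum_boole]
  refine (sum_le_sum fun ω _ => hmarkov ω).trans ?_
  rw [← mul_sum]
  have hindep : ∑ ω : Samples n k s, ∏ j, ∏ i, (1 + x (ω j i))
      = (∑ f : Fin s ↪ Fin n, ∏ i, (1 + x (f i))) ^ k := by
    have := prod_univ_sum (fun _ : Fin k => (univ : Finset (Fin s ↪ Fin n)))
      fun _ f => ∏ i, (1 + x (f i))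
    rw [prod_const, card_univ, Fintype.card_fin, Fintype.piFinset_univ] at this
    exact this.symm
  have hcard : (Fintype.card (Samples n k s) : ℝ) = (Fintype.card (Fin s ↪ Fin n) : ℝ) ^ k := by
    simp only [Fintype.card_pi, prod_const, card_univ, Fintype.card_fin, Nat.cast_pow]
  have hmgf := pow_le_pow_left₀ (sum_nonneg fun f _ => prod_nonneg fun i _ => by
    linarith [h0 (f i)]) (sum_embedding_prod_one_add_le x h0 s) k
  rw [hindep]
  refine (mul_le_mul_of_nonneg_left hmgf (Real.exp_pos _).le).trans (le_of_eq ?_)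
  rw [hcard, mul_pow, ← Real.exp_nat_mul, Fintype.card_fin, mul_left_comm, ← Real.exp_add]
  congr 2
  ring

theorem one_sub_le_probability {k s : ℕ} (hs : s ≤ n) {E : Samples n k s → Prop} {δ : ℝ}
    (G : Samples n k s → Prop) [DecidablePred G] (hG : ∀ ω, ¬ G ω → E ω)
    (hδ : ((univ.filter G).card : ℝ) ≤ Fintype.card (Samples n k s) * δ) :
    1 - δ ≤ probability E := by
  have hcard : (0 : ℝ) < Fintype.card (Samples n k s) := by exact_mod_cast card_samples_pos hs
  rw [probability, expectation, le_div_iff₀ hcard]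
  have h1 : ∑ ω : Samples n k s, (1 - if G ω then (1 : ℝ) else 0) ≤
      ∑ ω : Samples n k s, @ite ℝ (E ω) (Classical.propDecidable _) 1 0 := by
    refine sum_le_sum fun ω _ => ?_
    by_cases h : G ω
    · rw [if_pos h, sub_self]
      split_ifs <;> norm_num
    · rw [if_neg h, if_pos (hG ω h), sub_zero]
  refine le_trans ?_ h1
  rw [sum_sub_distrib, sum_boole, sum_const, card_univ, nsmul_eq_mul]
  linarith

/-- The total number of draws is `O(n log (1 / ε))`, for `ε` bounded away from `1`. -/
theorem mul_sampleSize_le {k : ℕ} {ε ε₀ : ℝ} (hk : 1 ≤ k) (hkn : k ≤ n) (hε : 0 < ε)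
    (hεε₀ : ε ≤ ε₀) (hε₀1 : ε₀ < 1) :
    (k : ℝ) * sampleSize n k ε ≤
      n * ((1 + 2 / Real.log (1 / ε₀)) * Real.log (1 / ε)) := by
  have hk0 : (0 : ℝ) < k := by exact_mod_cast hk
  have hkn' : (k : ℝ) ≤ n := by exact_mod_cast hkn
  have hε₀ : 0 < ε₀ := hε.trans_le hεε₀
  have hℓ₀ : 0 < Real.log (1 / ε₀) := Real.log_pos (by rw [lt_div_iff₀ hε₀]; linarith)
  have hℓ : Real.log (1 / ε₀) ≤ Real.log (1 / ε) :=
    Real.log_le_log (by positivity) (one_div_le_one_div_of_le hε hεε₀)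
  have hlog : Real.log (2 / ε) ≤ 1 + Real.log (1 / ε) := by
    have : (2 : ℝ) / ε = 2 * (1 / ε) := by ring
    rw [this, Real.log_mul (by norm_num) (by positivity)]
    linarith [Real.log_two_lt_d9]
  have hlog0 := half_le_log_two_div hε (hεε₀.trans_lt hε₀1)
  have hs : (sampleSize n k ε : ℝ) ≤ n / k * Real.log (2 / ε) + 1 := by
    have h1 : (sampleSize n k ε : ℝ) ≤ ⌈(n : ℝ) / k * Real.log (2 / ε)⌉₊ :=
      Nat.cast_le.mpr (min_le_right _ _)
    exact h1.trans (Nat.ceil_lt_add_one (mul_nonneg (by positivity) (by linarith))).le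
  have h2 : 2 ≤ 2 / Real.log (1 / ε₀) * Real.log (1 / ε) := by
    rw [div_mul_eq_mul_div, le_div_iff₀ hℓ₀]
    linarith
  calc (k : ℝ) * sampleSize n k ε ≤ k * (n / k * Real.log (2 / ε) + 1) :=
        mul_le_mul_of_nonneg_left hs hk0.le
    _ = n * Real.log (2 / ε) + k := by field_simp
    _ ≤ n * (Real.log (2 / ε) + 1) := by linarith
    _ ≤ _ := mul_le_mul_of_nonneg_left (by linarith) (by linarith)

theorem running_time_bound {c : ℝ} (hc : 0 < c) {ε₀ : ℝ} (hε₀ : 0 < ε₀) (hε₀1 : ε₀ < 1) :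
    ∃ K : ℝ, 0 < K ∧ ∀ (n m k t : ℕ) (ε : ℝ) (C : Fin m → Fin n → ℝ)
      (T : Fin m → Finset (Fin n)) (tie : Fin n → Fin n → Bool),
      (m : ℝ) ≤ c * n → 1 ≤ k → k ≤ n → 1 ≤ t → 0 < ε → ε ≤ ε₀ →
      IsNearestNeighborGraph C t T →
      1 - 1 / (n : ℝ) ≤ probability (fun ω : Samples n k (sampleSize n k ε) =>
        (runningTime (sparsify C T) T tie ω : ℝ) ≤
          K * (n * Real.log (1 / ε) * max (t : ℝ) (Real.log n))) := by
  set ℓ₀ := Real.log (1 / ε₀) with hℓ₀def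
  have hℓ₀ : 0 < ℓ₀ := Real.log_pos (by rw [lt_div_iff₀ hε₀]; linarith)
  set a := 1 + 2 / ℓ₀ with ha
  have ha0 : 0 < a := by positivity
  -- `K₁` makes the Chernoff exponent `2 a ℓ t - K₁ ℓ max (t, log n) / 2` at most `- log n`.
  set K₁ := 2 * (2 * a + 1 / ℓ₀) with hK₁
  have hK₁0 : 0 < K₁ := by positivity
  refine ⟨(2 * c + 3) / ℓ₀ + 5 * a + 11 * (c * K₁), by positivity, ?_⟩
  intro n m k t ε C T tie hmn hk hkn ht hε hεε₀ hT
  have hn0 : (0 : ℝ) < n := by exact_mod_cast hk.trans hkn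
  have hkn' : (k : ℝ) ≤ n := by exact_mod_cast hkn
  have ht1 : (1 : ℝ) ≤ t := by exact_mod_cast ht
  set s := sampleSize n k ε with hs
  set ℓ := Real.log (1 / ε) with hℓ
  have hℓℓ₀ : ℓ₀ ≤ ℓ :=
    Real.log_le_log (by positivity) (one_div_le_one_div_of_le hε hεε₀)
  have hℓ0 : 0 < ℓ := hℓ₀.trans_le hℓℓ₀
  set μ := max (t : ℝ) (Real.log n) with hμ
  have hμt : (t : ℝ) ≤ μ := le_max_left _ _
  have hμ1 : 1 ≤ μ := ht1.trans hμt
  have hks : (k : ℝ) * s ≤ n * (a * ℓ) := mul_sampleSize_le hk hkn hε hεε₀ hε₀1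
  have hM : 0 < c * n := mul_pos hc hn0
  let x : Fin n → ℝ := fun v => (neighbors T v).length / (c * n)
  have hx0 : ∀ v, 0 ≤ x v := fun v => by positivity
  have hx1 : ∀ v, x v ≤ 1 := fun v => by
    rw [div_le_one hM]
    exact (Nat.cast_le.mpr (length_neighbors_le T v)).trans hmn
  have hX : ∑ v, x v ≤ t := by
    rw [← sum_div, div_le_iff₀ hM, ← Nat.cast_sum, sum_length_neighbors]
    have h1 : ∑ i, (T i).card ≤ m * t := by
      calc ∑ i, (T i).card ≤ ∑ _i : Fin m, t :=
            sum_le_sum fun i _ => by rw [hT.card_eq]; exact min_le_left _ _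
        _ = m * t := by simp
    calc ((∑ i, (T i).card : ℕ) : ℝ) ≤ m * t := by exact_mod_cast h1
      _ ≤ t * (c * n) := by nlinarith
  refine one_sub_le_probability (sampleSize_le n k ε)
    (fun ω => K₁ * (ℓ * μ) < ∑ j, ∑ i, x (ω j i)) ?_ ?_
  · intro ω hω
    push Not at hω
    have htime : (runningTime (sparsify C T) T tie ω : ℝ) ≤
        2 * m + k * (3 + 5 * s) + 11 * ∑ j, ∑ i, ((neighbors T (ω j i)).length : ℝ) := by
      exact_mod_cast runningTime_le (sparsify C T) T tie ω
    have hW : ∑ j, ∑ i, ((neighbors T (ω j i)).length : ℝ) ≤ c * n * (K₁ * (ℓ * μ)) := by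
      simp only [x, ← sum_div] at hω
      rw [div_le_iff₀ hM] at hω
      linarith
    have h1 : 1 ≤ 1 / ℓ₀ * (ℓ * μ) := by
      rw [div_mul_eq_mul_div, one_mul, le_div_iff₀ hℓ₀]
      nlinarith
    have h2 : (2 * c + 3) * n ≤ (2 * c + 3) * n * (1 / ℓ₀ * (ℓ * μ)) :=
      le_mul_of_one_le_right (by positivity) h1
    have h3 : n * (a * ℓ) ≤ n * (a * ℓ) * μ := le_mul_of_one_le_right (by positivity) hμ1
    refine htime.trans ?_
    calc 2 * (m : ℝ) + k * (3 + 5 * s) + 11 * ∑ j, ∑ i, ((neighbors T (ω j i)).length : ℝ)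
        ≤ (2 * c + 3) * n * (1 / ℓ₀ * (ℓ * μ)) + 5 * (n * (a * ℓ) * μ)
          + 11 * (c * n * (K₁ * (ℓ * μ))) := by linarith
      _ = _ := by ring
  · refine (card_weight_gt_le (hk.trans hkn) x hx0 hx1 _).trans
      (mul_le_mul_of_nonneg_left ?_ (Nat.cast_nonneg _))
    have hlogn : (1 : ℝ) / n = Real.exp (-Real.log n) := by
      rw [Real.exp_neg, Real.exp_log hn0, one_div]
    rw [hlogn]
    refine Real.exp_le_exp.mpr ?_
    have h1 : 2 * ((k : ℝ) * s) * (∑ v, x v) / n ≤ 2 * (a * ℓ) * μ := by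
      rw [div_le_iff₀ hn0]
      calc 2 * ((k : ℝ) * s) * (∑ v, x v) ≤ 2 * (n * (a * ℓ)) * μ :=
            mul_le_mul (by linarith) (hX.trans hμt) (sum_nonneg fun v _ => hx0 v)
              (by positivity)
        _ = _ := by ring
    have h2 : Real.log n ≤ 1 / ℓ₀ * (ℓ * μ) := by
      rw [div_mul_eq_mul_div, one_mul, le_div_iff₀ hℓ₀]
      calc Real.log n * ℓ₀ ≤ μ * ℓ :=
            mul_le_mul (le_max_right _ _) hℓℓ₀ hℓ₀.le (by linarith)
        _ = ℓ * μ := mul_comm _ _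
    have h3 : K₁ * (ℓ * μ) / 2 = 2 * (a * ℓ) * μ + 1 / ℓ₀ * (ℓ * μ) := by
      rw [hK₁]; ring
    linarith

end FacilityLocation

end

theorem proposition4 :
    -- running time, with high probability
    (∀ c : ℝ, 0 < c → ∀ ε₀ : ℝ, 0 < ε₀ → ε₀ < 1 → ∃ K : ℝ, 0 < K ∧
      ∀ (n m k t : ℕ) (ε : ℝ) (C : Fin m → Fin n → ℝ) (T : Fin m → Finset (Fin n))
        (tie : Fin n → Fin n → Bool),
        (m : ℝ) ≤ c * n → 1 ≤ k → k ≤ n → 1 ≤ t → 0 < ε → ε ≤ ε₀ →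
        (∀ i v, 0 ≤ C i v) → FacilityLocation.IsNearestNeighborGraph C t T →
        1 - 1 / (n : ℝ) ≤ FacilityLocation.probability
          (fun ω : FacilityLocation.Samples n k (FacilityLocation.sampleSize n k ε) =>
            (FacilityLocation.runningTime (FacilityLocation.sparsify C T) T tie ω : ℝ) ≤
              K * (n * Real.log (1 / ε) * max (t : ℝ) (Real.log n)))) ∧
    -- order of magnitude of the sparsity threshold
    (∃ B : ℝ, 0 < B ∧ ∀ (n m k : ℕ) (ε : ℝ), 1 ≤ m → 1 ≤ k → k ≤ n → 0 < ε → ε < 1 →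
      (FacilityLocation.tStar n m k (ε / 2) : ℝ) ≤
        B * (n / (ε * k) * max 1 (Real.log (m / (ε * k))))) ∧
    -- approximation guarantee in expectation
    (∀ (n m k t : ℕ) (ε : ℝ) (C : Fin m → Fin n → ℝ) (T : Fin m → Finset (Fin n))
      (tie : Fin n → Fin n → Bool),
      1 ≤ m → 1 ≤ k → k ≤ n → 0 < ε → ε < 1 → (∀ i v, 0 ≤ C i v) →
      FacilityLocation.tStar n m k (ε / 2) ≤ t →
      FacilityLocation.IsNearestNeighborGraph C t T →
      (1 - 1 / Real.exp 1 - ε) * FacilityLocation.opt C k ≤ FacilityLocation.expectation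
        (fun ω : FacilityLocation.Samples n k (FacilityLocation.sampleSize n k ε) =>
          FacilityLocation.objective C
            (FacilityLocation.selected (FacilityLocation.sparsify C T) T tie ω))) := by
  refine ⟨fun c hc ε₀ hε₀ hε₀1 => ?_, ⟨13, by norm_num, ?_⟩, ?_⟩
  · obtain ⟨K, hK, h⟩ := FacilityLocation.running_time_bound hc hε₀ hε₀1
    exact ⟨K, hK, fun n m k t ε C T tie hmn hk hkn ht hε hεε₀ _ hT =>
      h n m k t ε C T tie hmn hk hkn ht hε hεε₀ hT⟩
  · exact fun n m k ε hm hk hkn hε hε1 => FacilityLocation.tStar_le hm hk hkn hε hε1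
  · exact fun n m k t ε C T tie hm hk hkn hε hε1 hC ht hT =>
      FacilityLocation.approximation_guarantee tie hm hk hkn hε hε1 hC ht hT
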